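/- Let $a>0$, $b>1$, $\beta>0$, $u\in(0,1)$, and $$A_0=\begin{pmatrix}-a&b\\-\frac1b&-a\end{pmatrix},\qquad A_1=\begin{pmatrix}-a&\frac1b\\-b&-a\end{pmatrix}.$$ Let $(I_t)_{t\ge0}$ be the Markov jump process on $\{0,1\}$ with jump rates $\lambda_0=\beta u$ (from $0$ to $1$) and $\lambda_1=\beta(1-u)$ (from $1$ to $0$), let $(X_t)_{t\ge0}$ be the continuous process in $\mathbb R^2\setminus\{0\}$ with $\dot X_t=A_{I_t}X_t$, and let $\Theta_t\in\mathbb R/2\pi\mathbb Z$ be the polar angle of $X_t$; it does not depend on $\|X_0\|$. Write $e_\theta=(\cos\theta,\sin\theta)$ and $d_i(\theta)=\langle A_ie_\theta,e_{\theta+\pi/2}\rangle$. Then $$d_0(\theta)=-b\sin^2\theta-\tfrac1b\cos^2\theta,\qquad d_1(\theta)=-\tfrac1b\sin^2\theta-b\cos^2\theta .$$ Let $v(\theta)=-\int_0^\theta\left(\frac{u}{d_0}+\frac{1-u}{d_1}\right)d\alpha$. The function $v$ is the primitive, null in zero, of $-\left(\frac u{d_0}+\frac{1-u}{d_1}\right)$;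 it satisfies $v(\theta)=u\arctan(b\tan\theta)+(1-u)\arctan\left(\tfrac1b\tan\theta\right)$ for $\theta\in(-\frac\pi2,\frac\pi2)$, and $v(\theta+\pi)=v(\theta)+\pi$ for all $\theta\in\mathbb R$. Define constants $\kappa$, $K$, $C$ by $$\frac1\kappa=-\beta(1-u)\int_0^\infty\frac{1}{d_1(\alpha)}e^{-\beta v(\alpha)}\,d\alpha,$$ $$\frac1K=\int_0^{2\pi}\left[e^{\beta v(\theta)}\left(1+\kappa\beta(1-u)\int_0^\theta\frac{1}{d_1(\alpha)}e^{-\beta v(\alpha)}\,d\alpha\right)\left(\frac1{d_0(\theta)}-\frac1{d_1(\theta)}\right)+\frac{\kappa}{d_1(\theta)}\right]d\theta,\qquad C=\kappa K .$$ These constants are well defined: the integral over $(0,\infty)$ converges absolutely, $\kappa>0$, $K<0$ and $C<0$. Put $$\Phi(\theta)=\left(K+\int_0^\theta\beta C(1-u)\frac1{d_1(\alpha)}e^{-\beta v(\alpha)}\,d\alpha\right)e^{\beta v(\theta)},\qquad \rho_0=\frac{\Phi}{d_0},\qquad \rho_1=\frac{C-\rho_0d_0}{d_1}.$$ Then $\Phi'=-\beta\Phi\left(\frac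 u{d_0}+\frac{1-u}{d_1}\right)+\frac{\beta C(1-u)}{d_1}$ on $\mathbb R$; the functions $\rho_0,\rho_1$ are continuous, $2\pi$-periodic and positive; and $\mu(d\theta,i)=\rho_i(\theta)\,d\theta$ is a probability measure on $(\mathbb R/2\pi\mathbb Z)\times\{0,1\}$ which is invariant for the process $((\Theta_t,I_t))_{t\ge0}$ and is its only invariant probability measure. -/

import Mathlib

open MeasureTheory ProbabilityTheory

noncomputable section

/-- Angles modulo `2π` carry their Borel σ-algebra. -/
instance Real.Angle.instMeasurableSpaceBorel : MeasurableSpace Real.Angle := borel Real.Angle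

instance Real.Angle.instBorelSpaceBorel : BorelSpace Real.Angle := ⟨rfl⟩

namespace SwitchedSystem

/-! ### The randomly switched planar system -/

/-- The matrices `A₀` and `A₁`. -/
def A (a b : ℝ) : Fin 2 → Matrix (Fin 2) (Fin 2) ℝ :=
  ![!![-a, b; -(1 / b), -a], !![-a, 1 / b; -b, -a]]

/-- The jump rates `λ₀ = β u` (from `0` to `1`) and `λ₁ = β (1 - u)` (from `1` to `0`). -/
def rate (β u : ℝ) : Fin 2 → ℝ := ![β * u, β * (1 - u)]

/-- The law of a sequence of independent exponential variables of parameter `1`. -/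
def clockLaw : Measure (ℕ → ℝ) := Measure.infinitePi fun _ : ℕ => expMeasure 1

/-- The mode after `n` jumps, started from mode `i`. -/
def modeAfter (i : Fin 2) : ℕ → Fin 2
  | 0 => i
  | n + 1 => 1 - modeAfter i n

/-- The time spent in the `n`-th visited mode. Under `clockLaw` these times are independent,
the `n`-th one being exponential with parameter the jump rate of the `n`-th visited mode. -/
def holdingTime (β u : ℝ) (i : Fin 2) (ω : ℕ → ℝ) (n : ℕ) : ℝ :=
  ω n / rate β u (modeAfter i n)

/-- The time of the `n`-th jump (the `0`-th one is at time `0`). -/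
def jumpTime (β u : ℝ) (i : Fin 2) (ω : ℕ → ℝ) (n : ℕ) : ℝ :=
  ∑ k ∈ Finset.range n, holdingTime β u i ω k

/-- The number of jumps up to time `t` (almost surely finite). -/
def jumpCount (β u : ℝ) (i : Fin 2) (ω : ℕ → ℝ) (t : ℝ) : ℕ :=
  sSup {n : ℕ | jumpTime β u i ω n ≤ t}

/-- The Markov jump process `I_t` with rates `λ₀`, `λ₁`, started from `i`. -/
def modeProcess (β u : ℝ) (i : Fin 2) (ω : ℕ → ℝ) (t : ℝ) : Fin 2 :=
  modeAfter i (jumpCount β u i ω t)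

/-- The position of `X` at the time of the `n`-th jump, started from `(x, i)`. -/
def jumpPosition (a b β u : ℝ) (x : Fin 2 → ℝ) (i : Fin 2) (ω : ℕ → ℝ) : ℕ → Fin 2 → ℝ
  | 0 => x
  | n + 1 => Matrix.mulVec
      (NormedSpace.exp (holdingTime β u i ω n • A a b (modeAfter i n)))
      (jumpPosition a b β u x i ω n)

/-- The continuous process `X_t` solving `X' = A_{I_t} X` with `X_0 = x` and `I_0 = i`: between
two jumps it follows the flow `exp (s A_i)` of the current mode. -/
def position (a b β u : ℝ) (x : Fin 2 → ℝ) (i : Fin 2) (ω : ℕ → ℝ) (t : ℝ) : Fin 2 → ℝ :=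
  Matrix.mulVec
    (NormedSpace.exp ((t - jumpTime β u i ω (jumpCount β u i ω t)) •
      A a b (modeProcess β u i ω t)))
    (jumpPosition a b β u x i ω (jumpCount β u i ω t))

/-- The polar angle, modulo `2π`, of a nonzero vector of the plane. -/
def polarAngle (x : Fin 2 → ℝ) : Real.Angle := ((Complex.arg ⟨x 0, x 1⟩ : ℝ) : Real.Angle)

/-- The angular process `(Θ_t, I_t)` as a function of the initial condition `(θ, i)` and the
clocks `ω`: `Θ_t` is the polar angle of `X_t`, where `X_0 = (cos θ, sin θ)`. -/
def angularProcess (a b β u t : ℝ) (z : (Real.Angle × Fin 2) × (ℕ → ℝ)) : Real.Angle × Fin 2 :=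
  (polarAngle (position a b β u ![z.1.1.cos, z.1.1.sin] z.1.2 z.2 t),
    modeProcess β u z.1.2 z.2 t)

/-- `μ` is invariant: if `(Θ_0, I_0)` has law `μ` and is independent of the clocks, then
`(Θ_t, I_t)` has law `μ` for every `t ≥ 0`. -/
def IsInvariant (a b β u : ℝ) (μ : Measure (Real.Angle × Fin 2)) : Prop :=
  ∀ t : ℝ, 0 ≤ t → MeasurePreserving (angularProcess a b β u t) (μ.prod clockLaw) μ

/-- The measure `ρ_i(θ) dθ` on the circle times `{0, 1}`, `θ` running through one period. -/
def densityMeasure (ρ : Fin 2 → ℝ → ℝ) : Measure (Real.Angle × Fin 2) :=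
  ∑ i : Fin 2, Measure.map (fun θ : ℝ => ((θ : Real.Angle), i))
    ((volume.restrict (Set.Ioc 0 (2 * Real.pi))).withDensity fun θ => ENNReal.ofReal (ρ i θ))

/-! ### The explicit formulas -/

/-- The unit vector `e_θ`. -/
def e (θ : ℝ) : Fin 2 → ℝ := ![Real.cos θ, Real.sin θ]

/-- `d_i(θ) = ⟨A_i e_θ, e_{θ+π/2}⟩`. -/
def d (a b : ℝ) (i : Fin 2) (θ : ℝ) : ℝ :=
  dotProduct (Matrix.mulVec (A a b i) (e θ)) (e (θ + Real.pi / 2))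

/-- The primitive, null in zero, of `-(u / d₀ + (1 - u) / d₁)`. -/
def v (a b u θ : ℝ) : ℝ := ∫ α in (0 : ℝ)..θ, -(u / d a b 0 α + (1 - u) / d a b 1 α)

/-- `1 / κ = - β (1 - u) ∫_0^∞ exp (-β v) / d₁`. -/
def kappa (a b β u : ℝ) : ℝ :=
  (-(β * (1 - u) * ∫ α in Set.Ioi (0 : ℝ), 1 / d a b 1 α * Real.exp (-(β * v a b u α))))⁻¹

def K (a b β u : ℝ) : ℝ :=
  (∫ θ in (0 : ℝ)..(2 * Real.pi),
    (Real.exp (β * v a b u θ) *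
      (1 + kappa a b β u * β * (1 - u) *
        ∫ α in (0 : ℝ)..θ, 1 / d a b 1 α * Real.exp (-(β * v a b u α))) *
      (1 / d a b 0 θ - 1 / d a b 1 θ) + kappa a b β u * (1 / d a b 1 θ)))⁻¹

def C (a b β u : ℝ) : ℝ := kappa a b β u * K a b β u

def Phi (a b β u θ : ℝ) : ℝ :=
  (K a b β u + ∫ α in (0 : ℝ)..θ,
    β * C a b β u * (1 - u) * (1 / d a b 1 α) * Real.exp (-(β * v a b u α))) *
  Real.exp (β * v a b u θ)

def rho0 (a b β u θ : ℝ) : ℝ := Phi a b β u θ / d a b 0 θ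

def rho1 (a b β u θ : ℝ) : ℝ := (C a b β u - rho0 a b β u θ * d a b 0 θ) / d a b 1 θ

/-- The densities `ρ₀` and `ρ₁`. -/
def rho (a b β u : ℝ) : Fin 2 → ℝ → ℝ := ![rho0 a b β u, rho1 a b β u]

end SwitchedSystem

end

/-!
**Angles.** Both matrices have the form `A_i = !![-a, k; -1/k, -a]` with `k = b` or `k = 1 / b`
(`axis`). Writing the angle as the polar angle `ellipseAngle k s` of `(k cos s, sin s)` rectifies
the angular flow of mode `i`: it becomes the translation `s ↦ s - t` (`flow_ellipseAngle`), and
`-1 / d_i` is the derivative of `ellipseAngle (1 / k)`. Hence `v` is a convex combination of two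
such angles, which gives its closed form and its behaviour under translation by `π`.

**Constants.** `Φ = C N` where the function
`N θ = -β (1 - u) exp (β v θ) ∫_θ^∞ exp (-β v) / d₁` (`profile`) is periodic with values in
`(0, 1)`, because `-β (u / d₀ + (1 - u) / d₁) exp (-β v)` is the derivative of `-exp (-β v)`. All the
signs follow: `ρ₀ = C N / d₀` and `ρ₁ = C (1 - N) / d₁`.

**Invariance.** The clocks are split into the first one and the others (`map_consClock`); this
yields the renewal equation `P_t = S_t + ∫_0^t S_r J P_{t-r} dr` (`transition_eq`), with `S_t` the
transport without jump and `J` the jump operator. In the rectifying coordinates, the stationary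
Fokker–Planck equation for `ρ` integrates to the dual identity `μ = μ S_t + ∫_0^t μ J S_q dq`
(`lintegral_duhamel`). Inserting one into the other, the terms with two jumps cancel and
`μ P_t = μ` remains (`lintegral_transition`); neither the regularity of `P_t f` nor the semigroup
property is needed.

**Uniqueness.** A short-time expansion of the renewal equation shows that an invariant probability
measure `ν` annihilates the generator (`integral_generator`). Tested on functions of the angle only,
this says that the current `d₀ ν₀ + d₁ ν₁` is a multiple of Lebesgue measure (`integral_current`).
Tested on `(p, 0)`, where `p` is the periodic solution of `p' + β v' p = g / d₀`, it then expresses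
`ν₀ g` through the current. So `ν` is determined up to the factor `rotationRate`
(`exists_functional`), and this factor is fixed by the total mass.
-/

namespace SwitchedSystem

/-! ### The rectifying coordinates of the angular flows -/

/-- The angular speed of `s ↦ (k cos s, sin s)`. -/
noncomputable def ellipseSpeed (k s : ℝ) : ℝ := k / (k ^ 2 * Real.cos s ^ 2 + Real.sin s ^ 2)

/-- The continuous determination, null at `0`, of the polar angle of `(k cos s, sin s)`. -/
noncomputable def ellipseAngle (k s : ℝ) : ℝ := ∫ α in (0 : ℝ)..s, ellipseSpeed k α

theorem ellipse_pos {k : ℝ} (hk : 0 < k) (s : ℝ) :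
    0 < k ^ 2 * Real.cos s ^ 2 + Real.sin s ^ 2 := by
  rcases eq_or_ne (Real.sin s) 0 with h | h
  · have := Real.sin_sq_add_cos_sq s
    rw [h] at this ⊢
    have h2 : Real.cos s ^ 2 = 1 := by linarith
    rw [h2]; positivity
  · positivity

theorem ellipseSpeed_pos {k : ℝ} (hk : 0 < k) (s : ℝ) : 0 < ellipseSpeed k s :=
  div_pos hk (ellipse_pos hk s)

theorem continuous_ellipseSpeed {k : ℝ} (hk : 0 < k) : Continuous (ellipseSpeed k) := by
  unfold ellipseSpeed
  exact continuous_const.div (by fun_prop) fun s => (ellipse_pos hk s).ne'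

theorem ellipseSpeed_add_pi (k s : ℝ) : ellipseSpeed k (s + Real.pi) = ellipseSpeed k s := by
  simp [ellipseSpeed, Real.cos_add_pi, Real.sin_add_pi]

theorem hasDerivAt_ellipseAngle {k : ℝ} (hk : 0 < k) (s : ℝ) :
    HasDerivAt (ellipseAngle k) (ellipseSpeed k s) s :=
  (continuous_ellipseSpeed hk).integral_hasStrictDerivAt 0 s |>.hasDerivAt

theorem continuous_ellipseAngle {k : ℝ} (hk : 0 < k) : Continuous (ellipseAngle k) :=
  continuous_iff_continuousAt.2 fun s => (hasDerivAt_ellipseAngle hk s).continuousAt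

@[simp] theorem ellipseAngle_zero (k : ℝ) : ellipseAngle k 0 = 0 := by simp [ellipseAngle]

theorem strictMono_ellipseAngle {k : ℝ} (hk : 0 < k) : StrictMono (ellipseAngle k) :=
  strictMono_of_deriv_pos fun s => by
    rw [(hasDerivAt_ellipseAngle hk s).deriv]; exact ellipseSpeed_pos hk s

theorem ellipseAngle_eq_arctan {k : ℝ} (hk : 0 < k) {s : ℝ}
    (hs : s ∈ Set.Ioo (-(Real.pi / 2)) (Real.pi / 2)) :
    ellipseAngle k s = Real.arctan (1 / k * Real.tan s) := by
  have hpi := Real.pi_pos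
  have hd : ∀ x ∈ Set.Ioo (-(Real.pi / 2)) (Real.pi / 2),
      HasDerivAt (fun x => ellipseAngle k x - Real.arctan (1 / k * Real.tan x)) 0 x := by
    intro x hx
    have hc : 0 < Real.cos x := Real.cos_pos_of_mem_Ioo hx
    have h := (hasDerivAt_ellipseAngle hk x).sub
      (((Real.hasDerivAt_tan hc.ne').const_mul (1 / k)).arctan)
    refine h.congr_deriv ?_
    have := ellipse_pos hk x
    have h3 : 1 + (1 / k * Real.tan x) ^ 2
        = (k ^ 2 * Real.cos x ^ 2 + Real.sin x ^ 2) / (k ^ 2 * Real.cos x ^ 2) := by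
      rw [Real.tan_eq_sin_div_cos]; field_simp
    rw [h3, ellipseSpeed]
    field_simp
    ring
  have hconst := (convex_Ioo (-(Real.pi / 2)) (Real.pi / 2)).is_const_of_fderivWithin_eq_zero
    (𝕜 := ℝ) (f := fun x => ellipseAngle k x - Real.arctan (1 / k * Real.tan x))
    (fun x hx => (hd x hx).differentiableAt.differentiableWithinAt)
    (fun x hx => by
      rw [fderivWithin_of_isOpen isOpen_Ioo hx]
      simpa using (hd x hx).hasFDerivAt.fderiv)
    hs (show (0 : ℝ) ∈ Set.Ioo (-(Real.pi / 2)) (Real.pi / 2) by constructor <;> linarith)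
  simp at hconst
  rw [one_div]
  linarith

theorem ellipseAngle_pi_div_two {k : ℝ} (hk : 0 < k) :
    ellipseAngle k (Real.pi / 2) = Real.pi / 2 := by
  have hpi := Real.pi_pos
  have h1 : Filter.Tendsto (ellipseAngle k) (nhdsWithin (Real.pi / 2) (Set.Iio (Real.pi / 2)))
      (nhds (ellipseAngle k (Real.pi / 2))) :=
    (continuous_ellipseAngle hk).continuousWithinAt
  have h2 : Filter.Tendsto (fun s => Real.arctan (1 / k * Real.tan s))
      (nhdsWithin (Real.pi / 2) (Set.Iio (Real.pi / 2))) (nhds (Real.pi / 2)) :=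
    (Real.tendsto_arctan_atTop.mono_right nhdsWithin_le_nhds).comp
      (Real.tendsto_tan_pi_div_two.const_mul_atTop (by positivity))
  refine tendsto_nhds_unique (h1.congr' ?_) h2
  filter_upwards [Ioo_mem_nhdsLT (show -(Real.pi / 2) < Real.pi / 2 by linarith)] with s hs
  exact ellipseAngle_eq_arctan hk hs

theorem ellipseAngle_neg (k s : ℝ) : ellipseAngle k (-s) = -ellipseAngle k s := by
  unfold ellipseAngle
  have h : ∀ x, ellipseSpeed k (-x) = ellipseSpeed k x := fun x => by simp [ellipseSpeed]
  have := intervalIntegral.integral_comp_neg (a := 0) (b := s) (ellipseSpeed k)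
  simp only [h, neg_zero] at this
  rw [this, intervalIntegral.integral_symm]

theorem ellipseAngle_add_pi {k : ℝ} (hk : 0 < k) (s : ℝ) :
    ellipseAngle k (s + Real.pi) = ellipseAngle k s + Real.pi := by
  have hint : ∀ x y, IntervalIntegrable (ellipseSpeed k) volume x y := fun x y =>
    (continuous_ellipseSpeed hk).intervalIntegrable _ _
  have hper : Function.Periodic (ellipseSpeed k) Real.pi := ellipseSpeed_add_pi k
  have h1 := hper.intervalIntegral_add_eq s (-(Real.pi / 2))
  have h2 := intervalIntegral.integral_interval_sub_left (hint 0 (s + Real.pi)) (hint 0 s)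
  have h3 := intervalIntegral.integral_interval_sub_left (hint 0 (-(Real.pi / 2) + Real.pi))
    (hint 0 (-(Real.pi / 2)))
  have h4 : -(Real.pi / 2) + Real.pi = Real.pi / 2 := by ring
  have h5 := ellipseAngle_pi_div_two hk
  have h6 := ellipseAngle_neg k (Real.pi / 2)
  rw [h4] at h1 h3
  unfold ellipseAngle at *
  linarith

theorem ellipseAngle_add_two_pi {k : ℝ} (hk : 0 < k) (s : ℝ) :
    ellipseAngle k (s + 2 * Real.pi) = ellipseAngle k s + 2 * Real.pi := by
  rw [show s + 2 * Real.pi = s + Real.pi + Real.pi by ring, ellipseAngle_add_pi hk,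
    ellipseAngle_add_pi hk]
  ring

theorem surjective_ellipseAngle {k : ℝ} (hk : 0 < k) : Function.Surjective (ellipseAngle k) := by
  have hn : ∀ n : ℕ, ellipseAngle k (n * Real.pi) = n * Real.pi := by
    intro n
    induction n with
    | zero => simp
    | succ n ih => push_cast; rw [add_mul, one_mul, ellipseAngle_add_pi hk, ih]
  intro y
  obtain ⟨n, hy⟩ := exists_nat_gt (|y| / Real.pi)
  rw [div_lt_iff₀ Real.pi_pos] at hy
  have h1 := neg_abs_le y
  have h2 := le_abs_self y
  have hpi := Real.pi_pos
  have := intermediate_value_Icc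
    (show -((n : ℝ) * Real.pi) ≤ n * Real.pi by linarith [abs_nonneg y])
    (continuous_ellipseAngle hk).continuousOn
  obtain ⟨x, -, hx⟩ := this (show y ∈ _ by
    rw [ellipseAngle_neg, hn]; constructor <;> linarith)
  exact ⟨x, hx⟩

/-- `ellipseAngle k s` is a polar angle of `(k cos s, sin s)`: the two scaled components of this
vector along and across the direction `ellipseAngle k s` have zero derivative. -/
theorem ellipse_polar {k : ℝ} (hk : 0 < k) (s : ℝ) :
    k * Real.cos s = Real.sqrt (k ^ 2 * Real.cos s ^ 2 + Real.sin s ^ 2) *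
        Real.cos (ellipseAngle k s) ∧
      Real.sin s = Real.sqrt (k ^ 2 * Real.cos s ^ 2 + Real.sin s ^ 2) *
        Real.sin (ellipseAngle k s) := by
  set r : ℝ → ℝ := fun s => Real.sqrt (k ^ 2 * Real.cos s ^ 2 + Real.sin s ^ 2) with hr
  have hr2 : ∀ s, r s ^ 2 = k ^ 2 * Real.cos s ^ 2 + Real.sin s ^ 2 := fun s =>
    Real.sq_sqrt (ellipse_pos hk s).le
  have hrpos : ∀ s, 0 < r s := fun s => Real.sqrt_pos.2 (ellipse_pos hk s)
  have hrd : ∀ s, HasDerivAt r ((1 - k ^ 2) * Real.sin s * Real.cos s / r s) s := by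
    intro s
    have h := ((((Real.hasDerivAt_cos s).pow 2).const_mul (k ^ 2)).add
      ((Real.hasDerivAt_sin s).pow 2)).sqrt (ellipse_pos hk s).ne'
    refine h.congr_deriv ?_
    have h1 := (hrpos s).ne'
    change _ / (2 * r s) = _
    push_cast
    field_simp
    ring
  have hx : ∀ s, HasDerivAt (fun s => (k * Real.cos s * Real.cos (ellipseAngle k s)
      + Real.sin s * Real.sin (ellipseAngle k s)) / r s) 0 s := by
    intro s
    have hw := hasDerivAt_ellipseAngle hk s
    have h := (((((Real.hasDerivAt_cos s).const_mul k).mul hw.cos)).add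
      ((Real.hasDerivAt_sin s).mul hw.sin)).div (hrd s) (hrpos s).ne'
    refine h.congr_deriv ?_
    change (_ * _ - (k * Real.cos s * Real.cos (ellipseAngle k s)
      + Real.sin s * Real.sin (ellipseAngle k s)) * _) / _ = 0
    have h1 := (hrpos s).ne'
    have h2 := (ellipse_pos hk s).ne'
    have h4 := Real.sin_sq_add_cos_sq s
    unfold ellipseSpeed
    rw [← hr2]
    field_simp
    rw [hr2]
    set S := Real.sin s
    set c := Real.cos s
    linear_combination (k ^ 2 * c * Real.sin (ellipseAngle k s)
      - k * S * Real.cos (ellipseAngle k s)) * h4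
  have hy : ∀ s, HasDerivAt (fun s => (k * Real.cos s * Real.sin (ellipseAngle k s)
      - Real.sin s * Real.cos (ellipseAngle k s)) / r s) 0 s := by
    intro s
    have hw := hasDerivAt_ellipseAngle hk s
    have h := (((((Real.hasDerivAt_cos s).const_mul k).mul hw.sin)).sub
      ((Real.hasDerivAt_sin s).mul hw.cos)).div (hrd s) (hrpos s).ne'
    refine h.congr_deriv ?_
    change (_ * _ - (k * Real.cos s * Real.sin (ellipseAngle k s)
      - Real.sin s * Real.cos (ellipseAngle k s)) * _) / _ = 0
    have h1 := (hrpos s).ne'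
    have h2 := (ellipse_pos hk s).ne'
    have h4 := Real.sin_sq_add_cos_sq s
    unfold ellipseSpeed
    rw [← hr2]
    field_simp
    rw [hr2]
    set S := Real.sin s
    set c := Real.cos s
    linear_combination (-(k * S * Real.sin (ellipseAngle k s))
      - k ^ 2 * c * Real.cos (ellipseAngle k s)) * h4
  have hx1 := is_const_of_deriv_eq_zero (fun s => (hx s).differentiableAt)
    (fun s => (hx s).deriv) s 0
  have hy1 := is_const_of_deriv_eq_zero (fun s => (hy s).differentiableAt)
    (fun s => (hy s).deriv) s 0
  have hr0 : r 0 = k := by simp [hr, Real.sqrt_sq hk.le]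
  simp only [ellipseAngle_zero, Real.cos_zero, Real.sin_zero, hr0] at hx1 hy1
  rw [div_eq_iff (hrpos s).ne'] at hx1 hy1
  have h5 := Real.sin_sq_add_cos_sq (ellipseAngle k s)
  have hk' : k * 1 * 1 + 0 * 0 = k := by ring
  rw [hk', div_self hk.ne'] at hx1
  simp at hy1
  change k * Real.cos s = r s * _ ∧ Real.sin s = r s * _
  constructor
  · linear_combination Real.cos (ellipseAngle k s) * hx1 + Real.sin (ellipseAngle k s) * hy1
      - k * Real.cos s * h5
  · linear_combination Real.sin (ellipseAngle k s) * hx1 - Real.cos (ellipseAngle k s) * hy1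
      - Real.sin s * h5

theorem ellipseSpeed_eq {k : ℝ} (hk : 0 < k) (s : ℝ) :
    ellipseSpeed k s =
      k * Real.sin (ellipseAngle k s) ^ 2 + 1 / k * Real.cos (ellipseAngle k s) ^ 2 := by
  obtain ⟨h1, h2⟩ := ellipse_polar hk s
  have hp := ellipse_pos hk s
  have hsq := Real.sq_sqrt hp.le
  set r := Real.sqrt (k ^ 2 * Real.cos s ^ 2 + Real.sin s ^ 2)
  have h4 := Real.sin_sq_add_cos_sq s
  unfold ellipseSpeed
  rw [← hsq] at hp ⊢
  rw [div_eq_iff hp.ne']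
  field_simp
  have h3 : k ^ 2 = k ^ 2 * (r * Real.sin (ellipseAngle k s)) ^ 2
      + (r * Real.cos (ellipseAngle k s)) ^ 2 := by
    rw [← h1, ← h2]
    linear_combination -k ^ 2 * h4
  linear_combination h3

/-! ### The angular speeds and the function `v` -/

/-- The half-axis `k` of mode `i`: the orbits of `A_i` on the projective line are those of
`s ↦ (k cos s, sin s)` run backwards. -/
noncomputable def axis (b : ℝ) : Fin 2 → ℝ := ![b, 1 / b]

theorem axis_pos {b : ℝ} (hb : 0 < b) (i : Fin 2) : 0 < axis b i := by
  fin_cases i <;> simp [axis, hb]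

theorem A_eq (a b : ℝ) (i : Fin 2) : A a b i = !![-a, axis b i; -(1 / axis b i), -a] := by
  fin_cases i <;> simp [A, axis]

theorem d_eq (a b : ℝ) (i : Fin 2) (θ : ℝ) :
    d a b i θ = -(axis b i * Real.sin θ ^ 2 + 1 / axis b i * Real.cos θ ^ 2) := by
  rw [d, A_eq]
  simp [e, Matrix.mulVec, dotProduct, Fin.sum_univ_two, Real.cos_add_pi_div_two,
    Real.sin_add_pi_div_two]
  ring

theorem inv_d {b : ℝ} (hb : 0 < b) (a : ℝ) (i : Fin 2) (θ : ℝ) :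
    1 / d a b i θ = -ellipseSpeed (1 / axis b i) θ := by
  have hk := axis_pos hb i
  have := ellipse_pos (one_div_pos.2 hk) θ
  rw [d_eq, ellipseSpeed, one_div_neg_eq_neg_one_div, neg_inj]
  have h2 : axis b i * Real.sin θ ^ 2 + 1 / axis b i * Real.cos θ ^ 2 =
    axis b i * ((1 / axis b i) ^ 2 * Real.cos θ ^ 2 + Real.sin θ ^ 2) := by
    field_simp; ring
  rw [h2, div_mul_eq_div_div]

theorem d_neg {b : ℝ} (hb : 0 < b) (a : ℝ) (i : Fin 2) (θ : ℝ) : d a b i θ < 0 := by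
  rw [← one_div_neg, inv_d hb]
  exact neg_neg_of_pos (ellipseSpeed_pos (one_div_pos.2 (axis_pos hb i)) θ)

theorem continuous_d (a b : ℝ) (i : Fin 2) : Continuous (d a b i) := by
  rw [funext (d_eq a b i)]; fun_prop

theorem d_periodic (a b : ℝ) (i : Fin 2) : Function.Periodic (d a b i) (2 * Real.pi) := by
  intro x; simp [d_eq]

theorem continuous_inv_d {b : ℝ} (hb : 0 < b) (a : ℝ) (i : Fin 2) :
    Continuous fun θ => 1 / d a b i θ :=
  continuous_const.div (continuous_d a b i) fun θ => (d_neg hb a i θ).ne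

/-- Along `ellipseAngle (axis b i)`, the mode `i` moves with angular speed `d_i`, backwards. -/
theorem ellipseSpeed_eq_neg_d {b : ℝ} (hb : 0 < b) (a : ℝ) (i : Fin 2) (s : ℝ) :
    ellipseSpeed (axis b i) s = -d a b i (ellipseAngle (axis b i) s) := by
  rw [ellipseSpeed_eq (axis_pos hb i), d_eq, neg_neg]

theorem v_eq {b : ℝ} (hb : 0 < b) (a u θ : ℝ) :
    v a b u θ = u * ellipseAngle (1 / b) θ + (1 - u) * ellipseAngle b θ := by
  have hb' := one_div_pos.2 hb
  unfold v ellipseAngle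
  rw [← intervalIntegral.integral_const_mul, ← intervalIntegral.integral_const_mul,
    ← intervalIntegral.integral_add]
  · refine intervalIntegral.integral_congr fun x _ => ?_
    have h0 := inv_d hb a 0 x
    have h1 := inv_d hb a 1 x
    simp [axis] at h0 h1
    simp only [div_eq_mul_inv, h0, h1]
    simp
    ring
  · exact ((continuous_ellipseSpeed hb').const_mul u).intervalIntegrable _ _
  · exact ((continuous_ellipseSpeed hb).const_mul (1 - u)).intervalIntegrable _ _

theorem hasDerivAt_v {b : ℝ} (hb : 0 < b) (a u θ : ℝ) :
    HasDerivAt (v a b u) (-(u / d a b 0 θ + (1 - u) / d a b 1 θ)) θ := by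
  rw [funext (v_eq hb a u)]
  have := ((hasDerivAt_ellipseAngle (one_div_pos.2 hb) θ).const_mul u).add
    ((hasDerivAt_ellipseAngle hb θ).const_mul (1 - u))
  refine this.congr_deriv ?_
  have h0 := inv_d hb a 0 θ
  have h1 := inv_d hb a 1 θ
  simp [axis] at h0 h1
  simp only [div_eq_mul_inv, h0, h1]
  simp
  ring

theorem continuous_v {b : ℝ} (hb : 0 < b) (a u : ℝ) : Continuous (v a b u) :=
  continuous_iff_continuousAt.2 fun s => (hasDerivAt_v hb a u s).continuousAt

theorem v_eq_arctan {b : ℝ} (hb : 0 < b) (a u : ℝ) {θ : ℝ}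
    (hθ : θ ∈ Set.Ioo (-(Real.pi / 2)) (Real.pi / 2)) :
    v a b u θ =
      u * Real.arctan (b * Real.tan θ) + (1 - u) * Real.arctan (1 / b * Real.tan θ) := by
  rw [v_eq hb, ellipseAngle_eq_arctan hb hθ, ellipseAngle_eq_arctan (one_div_pos.2 hb) hθ,
    one_div_one_div]

theorem v_add_pi {b : ℝ} (hb : 0 < b) (a u θ : ℝ) :
    v a b u (θ + Real.pi) = v a b u θ + Real.pi := by
  rw [v_eq hb, v_eq hb, ellipseAngle_add_pi hb, ellipseAngle_add_pi (one_div_pos.2 hb)]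
  ring

theorem v_add_two_pi {b : ℝ} (hb : 0 < b) (a u θ : ℝ) :
    v a b u (θ + 2 * Real.pi) = v a b u θ + 2 * Real.pi := by
  rw [two_mul, ← add_assoc, v_add_pi hb, v_add_pi hb]
  ring

/-! ### The constants and the explicit densities -/

theorem tendsto_ellipseAngle_atTop {k : ℝ} (hk : 0 < k) :
    Filter.Tendsto (ellipseAngle k) Filter.atTop Filter.atTop :=
  Filter.tendsto_atTop_atTop.2 fun y => by
    obtain ⟨x, rfl⟩ := surjective_ellipseAngle hk y
    exact ⟨x, fun z hz => (strictMono_ellipseAngle hk).monotone hz⟩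

theorem tendsto_v_atTop {b u : ℝ} (hb : 0 < b) (a : ℝ) (hu : u ∈ Set.Ioo (0 : ℝ) 1) :
    Filter.Tendsto (v a b u) Filter.atTop Filter.atTop := by
  rw [funext (v_eq hb a u)]
  exact ((tendsto_ellipseAngle_atTop (one_div_pos.2 hb)).const_mul_atTop hu.1).atTop_add_atTop
    ((tendsto_ellipseAngle_atTop hb).const_mul_atTop (sub_pos.2 hu.2))

section Constants

variable {b β u : ℝ} (hb : 0 < b) (a : ℝ) (hβ : 0 < β) (hu : u ∈ Set.Ioo (0 : ℝ) 1)
include hb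

theorem hasDerivAt_exp_neg_v (β u θ : ℝ) :
    HasDerivAt (fun x => -Real.exp (-(β * v a b u x)))
      (-β * (u / d a b 0 θ + (1 - u) / d a b 1 θ) * Real.exp (-(β * v a b u θ))) θ := by
  have h := (((hasDerivAt_v hb a u θ).const_mul β).neg.exp).neg
  refine h.congr_deriv ?_
  simp only [Pi.neg_apply]
  ring

theorem continuous_exp_neg_v (β u : ℝ) :
    Continuous fun x => Real.exp (-(β * v a b u x)) :=
  Real.continuous_exp.comp ((continuous_v hb a u).const_mul β).neg

include hβ hu

theorem tendsto_exp_neg_v :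
    Filter.Tendsto (fun x => -Real.exp (-(β * v a b u x))) Filter.atTop (nhds 0) := by
  have := (Real.tendsto_exp_neg_atTop_nhds_zero.comp
    ((tendsto_v_atTop hb a hu).const_mul_atTop hβ)).neg
  simpa using this

theorem deriv_exp_neg_v_pos (θ : ℝ) :
    0 < -β * (u / d a b 0 θ + (1 - u) / d a b 1 θ) * Real.exp (-(β * v a b u θ)) := by
  have h0 := div_neg_of_pos_of_neg hu.1 (d_neg hb a 0 θ)
  have h1 := div_neg_of_pos_of_neg (sub_pos.2 hu.2) (d_neg hb a 1 θ)
  have := Real.exp_pos (-(β * v a b u θ))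
  have h2 : 0 < -(u / d a b 0 θ + (1 - u) / d a b 1 θ) := by linarith
  have := mul_pos (mul_pos hβ h2) this
  linarith

theorem integrableOn_deriv_exp_neg_v (θ : ℝ) :
    IntegrableOn (fun x => -β * (u / d a b 0 x + (1 - u) / d a b 1 x) *
      Real.exp (-(β * v a b u x))) (Set.Ioi θ) :=
  integrableOn_Ioi_deriv_of_nonneg' (fun x _ => hasDerivAt_exp_neg_v hb a β u x)
    (fun x _ => (deriv_exp_neg_v_pos hb a hβ hu x).le) (tendsto_exp_neg_v hb a hβ hu)

theorem integral_deriv_exp_neg_v (θ : ℝ) :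
    ∫ x in Set.Ioi θ, -β * (u / d a b 0 x + (1 - u) / d a b 1 x) *
      Real.exp (-(β * v a b u x)) = Real.exp (-(β * v a b u θ)) := by
  rw [integral_Ioi_of_hasDerivAt_of_nonneg' (fun x _ => hasDerivAt_exp_neg_v hb a β u x)
    (fun x _ => (deriv_exp_neg_v_pos hb a hβ hu x).le) (tendsto_exp_neg_v hb a hβ hu)]
  ring

omit hβ hu in
theorem continuous_weight (β u : ℝ) :
    Continuous fun x => 1 / d a b 1 x * Real.exp (-(β * v a b u x)) :=
  (continuous_inv_d hb a 1).mul (continuous_exp_neg_v hb a β u)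

theorem integrableOn_weight (θ : ℝ) :
    IntegrableOn (fun x => 1 / d a b 1 x * Real.exp (-(β * v a b u x))) (Set.Ioi θ) := by
  refine ((integrableOn_deriv_exp_neg_v hb a hβ hu θ).const_mul (1 / (β * (1 - u)))).mono'
    (continuous_weight hb a β u).aestronglyMeasurable (Filter.Eventually.of_forall fun x => ?_)
  have h0 := div_neg_of_pos_of_neg hu.1 (d_neg hb a 0 x)
  have h1 := d_neg hb a 1 x
  have hE := Real.exp_pos (-(β * v a b u x))
  have hu1 : 0 < 1 - u := sub_pos.2 hu.2
  rw [norm_mul, Real.norm_of_nonpos (one_div_neg.2 h1).le, Real.norm_of_nonneg hE.le]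
  have : 1 / (β * (1 - u)) * (-β * (u / d a b 0 x + (1 - u) / d a b 1 x) *
      Real.exp (-(β * v a b u x))) = -(1 / d a b 1 x) * Real.exp (-(β * v a b u x))
      + (-(u / d a b 0 x) / (1 - u)) * Real.exp (-(β * v a b u x)) := by
    field_simp
    ring
  rw [this]
  have := mul_pos (div_pos (neg_pos.2 h0) hu1) hE
  linarith

end Constants

/-- The positive weight `-exp (-β v) / d₁` integrated over `(θ, ∞)` and renormalised: up to the
factor `C`, this is the function `Φ`. -/
noncomputable def profile (a b β u θ : ℝ) : ℝ :=
  β * (1 - u) * Real.exp (β * v a b u θ) *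
    -∫ x in Set.Ioi θ, 1 / d a b 1 x * Real.exp (-(β * v a b u x))

section Constants

variable {b β u : ℝ} (hb : 0 < b) (a : ℝ) (hβ : 0 < β) (hu : u ∈ Set.Ioo (0 : ℝ) 1)
include hb hβ hu

theorem integral_weight_neg (θ : ℝ) :
    ∫ x in Set.Ioi θ, 1 / d a b 1 x * Real.exp (-(β * v a b u x)) < 0 := by
  rw [← neg_pos, ← integral_neg, setIntegral_pos_iff_support_of_nonneg_ae]
  · have : Function.support (fun x => -(1 / d a b 1 x * Real.exp (-(β * v a b u x)))) =
        Set.univ := by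
      ext x
      have h1 := one_div_neg.2 (d_neg hb a 1 x)
      simpa using h1.ne
    rw [this]
    simp
  · filter_upwards with x
    have h1 := one_div_neg.2 (d_neg hb a 1 x)
    have hE := Real.exp_pos (-(β * v a b u x))
    have := mul_pos (neg_pos.2 h1) hE
    simp only [Pi.zero_apply]
    linarith
  · exact (integrableOn_weight hb a hβ hu θ).neg

theorem profile_pos (θ : ℝ) : 0 < profile a b β u θ := by
  have hu1 : 0 < 1 - u := sub_pos.2 hu.2
  have h := neg_pos.2 (integral_weight_neg hb a hβ hu θ)
  unfold profile
  positivity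

theorem profile_lt_one (θ : ℝ) : profile a b β u θ < 1 := by
  have hu1 : 0 < 1 - u := sub_pos.2 hu.2
  have h := integral_deriv_exp_neg_v hb a hβ hu θ
  have hwint : IntegrableOn (fun x => β * (1 - u) *
      -(1 / d a b 1 x * Real.exp (-(β * v a b u x)))) (Set.Ioi θ) :=
    (integrableOn_weight hb a hβ hu θ).neg.const_mul _
  have hlt : β * (1 - u) * -∫ x in Set.Ioi θ, 1 / d a b 1 x * Real.exp (-(β * v a b u x)) <
      Real.exp (-(β * v a b u θ)) := by
    rw [← h, ← integral_neg, ← integral_const_mul, ← sub_pos, ← integral_sub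
      (integrableOn_deriv_exp_neg_v hb a hβ hu θ) hwint]
    have hpos : ∀ x, 0 < -β * (u / d a b 0 x + (1 - u) / d a b 1 x) *
        Real.exp (-(β * v a b u x)) -
        β * (1 - u) * -(1 / d a b 1 x * Real.exp (-(β * v a b u x))) := by
      intro x
      have h0 := div_neg_of_pos_of_neg hu.1 (d_neg hb a 0 x)
      have := mul_pos (mul_pos hβ (neg_pos.2 h0)) (Real.exp_pos (-(β * v a b u x)))
      calc (0 : ℝ) < _ := this
        _ = _ := by ring
    change 0 < ∫ x in Set.Ioi θ, _
    rw [setIntegral_pos_iff_support_of_nonneg_ae]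
    · have : Function.support (fun x => -β * (u / d a b 0 x + (1 - u) / d a b 1 x) *
          Real.exp (-(β * v a b u x)) -
          β * (1 - u) * -(1 / d a b 1 x * Real.exp (-(β * v a b u x)))) = Set.univ := by
        ext x
        exact iff_of_true (hpos x).ne' trivial
      rw [this]
      simp
    · filter_upwards with x using (hpos x).le
    · exact (integrableOn_deriv_exp_neg_v hb a hβ hu θ).sub hwint
  have h2 := mul_lt_mul_of_pos_left hlt (Real.exp_pos (β * v a b u θ))
  rw [← Real.exp_add, add_neg_cancel, Real.exp_zero] at h2
  calc profile a b β u θ = _ := by unfold profile; ring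
    _ < 1 := h2

omit hβ hu in
theorem profile_periodic : Function.Periodic (profile a b β u) (2 * Real.pi) := by
  intro θ
  have h := (measurePreserving_add_right volume (2 * Real.pi)).setIntegral_preimage_emb
    (measurableEmbedding_addRight _) (fun x => 1 / d a b 1 x * Real.exp (-(β * v a b u x)))
    (Set.Ioi (θ + 2 * Real.pi))
  rw [Set.preimage_add_const_Ioi, add_sub_cancel_right] at h
  have h2 : ∀ x, 1 / d a b 1 (x + 2 * Real.pi) * Real.exp (-(β * v a b u (x + 2 * Real.pi))) =
      Real.exp (-(β * (2 * Real.pi))) * (1 / d a b 1 x * Real.exp (-(β * v a b u x))) := by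
    intro x
    rw [d_periodic, v_add_two_pi hb, mul_add, neg_add, Real.exp_add]
    ring
  simp only [h2] at h
  rw [integral_const_mul] at h
  unfold profile
  rw [← h, v_add_two_pi hb, mul_add, Real.exp_add]
  have : Real.exp (β * (2 * Real.pi)) * Real.exp (-(β * (2 * Real.pi))) = 1 := by
    rw [← Real.exp_add, add_neg_cancel, Real.exp_zero]
  linear_combination (-(β * (1 - u) * Real.exp (β * v a b u θ) *
    ∫ x in Set.Ioi θ, 1 / d a b 1 x * Real.exp (-(β * v a b u x)))) * this

omit hb hβ hu in
theorem kappa_inv (b β u : ℝ) : (kappa a b β u)⁻¹ = profile a b β u 0 := by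
  have : v a b u 0 = 0 := by simp [v]
  simp only [kappa, profile, inv_inv, this, mul_zero, Real.exp_zero]
  ring

theorem kappa_pos : 0 < kappa a b β u := by
  rw [← inv_pos, kappa_inv a b β u]
  exact profile_pos hb a hβ hu 0

theorem exp_mul_eq_profile (θ : ℝ) : Real.exp (β * v a b u θ) *
      (1 + kappa a b β u * β * (1 - u) *
        ∫ α in (0 : ℝ)..θ, 1 / d a b 1 α * Real.exp (-(β * v a b u α))) =
      kappa a b β u * profile a b β u θ := by
  have hint := integrableOn_weight hb a hβ hu
  have hk := kappa_pos hb a hβ hu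
  have hinv := kappa_inv a b β u
  have hsplit : (∫ α in (0 : ℝ)..θ, 1 / d a b 1 α * Real.exp (-(β * v a b u α))) =
      (∫ x in Set.Ioi 0, 1 / d a b 1 x * Real.exp (-(β * v a b u x))) -
      ∫ x in Set.Ioi θ, 1 / d a b 1 x * Real.exp (-(β * v a b u x)) :=
    (intervalIntegral.integral_Ioi_sub_Ioi' (hint 0) (hint θ)).symm
  rw [hsplit]
  have hv : v a b u 0 = 0 := by simp [v]
  have h1 : kappa a b β u * profile a b β u 0 = 1 := by rw [← hinv, mul_inv_cancel₀ hk.ne']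
  unfold profile at h1 ⊢
  rw [hv, mul_zero, Real.exp_zero] at h1
  linear_combination -Real.exp (β * v a b u θ) * h1

theorem Phi_eq (θ : ℝ) : Phi a b β u θ = C a b β u * profile a b β u θ := by
  have h := exp_mul_eq_profile hb a hβ hu θ
  have h2 : (∫ α in (0 : ℝ)..θ,
      β * C a b β u * (1 - u) * (1 / d a b 1 α) * Real.exp (-(β * v a b u α))) =
      β * C a b β u * (1 - u) *
        ∫ α in (0 : ℝ)..θ, 1 / d a b 1 α * Real.exp (-(β * v a b u α)) := by
    rw [← intervalIntegral.integral_const_mul]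
    simp only [mul_assoc]
  rw [Phi, h2]
  unfold C
  linear_combination K a b β u * h

omit hβ hu in
theorem hasDerivAt_Phi (θ : ℝ) :
    HasDerivAt (Phi a b β u)
      (-β * Phi a b β u θ * (u / d a b 0 θ + (1 - u) / d a b 1 θ) +
        β * C a b β u * (1 - u) / d a b 1 θ) θ := by
  have hc : Continuous fun α => β * C a b β u * (1 - u) * (1 / d a b 1 α) *
      Real.exp (-(β * v a b u α)) :=
    ((continuous_inv_d hb a 1).const_mul _).mul (continuous_exp_neg_v hb a β u)
  have h1 := ((hc.integral_hasStrictDerivAt 0 θ).hasDerivAt.const_add (K a b β u)).mul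
    (((hasDerivAt_v hb a u θ).const_mul β).exp)
  refine h1.congr_deriv ?_
  have hE : Real.exp (-(β * v a b u θ)) * Real.exp (β * v a b u θ) = 1 := by
    rw [← Real.exp_add, neg_add_cancel, Real.exp_zero]
  unfold Phi
  linear_combination (β * C a b β u * (1 - u) * (1 / d a b 1 θ)) * hE

theorem continuous_profile : Continuous (profile a b β u) := by
  unfold profile
  have hint := integrableOn_weight hb a hβ hu
  have : (fun θ => ∫ x in Set.Ioi θ, 1 / d a b 1 x * Real.exp (-(β * v a b u x))) = fun θ =>
      (∫ x in Set.Ioi 0, 1 / d a b 1 x * Real.exp (-(β * v a b u x))) -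
      ∫ α in (0 : ℝ)..θ, 1 / d a b 1 α * Real.exp (-(β * v a b u α)) := by
    ext θ
    rw [← intervalIntegral.integral_Ioi_sub_Ioi' (hint 0) (hint θ)]
    ring
  refine Continuous.mul (continuous_const.mul (Real.continuous_exp.comp
    ((continuous_v hb a u).const_mul β))) (Continuous.neg ?_)
  rw [this]
  exact continuous_const.sub (intervalIntegral.continuous_primitive
    (fun x y => (continuous_weight hb a β u).intervalIntegrable x y) 0)

theorem K_inv : (K a b β u)⁻¹ = kappa a b β u * ∫ θ in (0 : ℝ)..(2 * Real.pi),
    (profile a b β u θ * (1 / d a b 0 θ) + (1 - profile a b β u θ) * (1 / d a b 1 θ)) := by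
  rw [K, inv_inv, ← intervalIntegral.integral_const_mul]
  refine intervalIntegral.integral_congr fun θ _ => ?_
  rw [exp_mul_eq_profile hb a hβ hu]
  ring

theorem mass_integrand_neg (θ : ℝ) :
    profile a b β u θ * (1 / d a b 0 θ) + (1 - profile a b β u θ) * (1 / d a b 1 θ) < 0 := by
  have h1 := mul_neg_of_pos_of_neg (profile_pos hb a hβ hu θ) (one_div_neg.2 (d_neg hb a 0 θ))
  have h2 := mul_neg_of_pos_of_neg (sub_pos.2 (profile_lt_one hb a hβ hu θ))
    (one_div_neg.2 (d_neg hb a 1 θ))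
  linarith

theorem continuous_mass_integrand : Continuous fun θ =>
    profile a b β u θ * (1 / d a b 0 θ) + (1 - profile a b β u θ) * (1 / d a b 1 θ) :=
  ((continuous_profile hb a hβ hu).mul (continuous_inv_d hb a 0)).add
    ((continuous_const.sub (continuous_profile hb a hβ hu)).mul (continuous_inv_d hb a 1))

theorem mass_neg : ∫ θ in (0 : ℝ)..(2 * Real.pi),
    (profile a b β u θ * (1 / d a b 0 θ) + (1 - profile a b β u θ) * (1 / d a b 1 θ)) < 0 := by
  rw [← neg_pos, ← intervalIntegral.integral_neg]
  exact intervalIntegral.intervalIntegral_pos_of_pos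
    ((continuous_mass_integrand hb a hβ hu).neg.intervalIntegrable _ _)
    (fun x => neg_pos.2 (mass_integrand_neg hb a hβ hu x)) Real.two_pi_pos

theorem K_neg : K a b β u < 0 := by
  rw [← inv_lt_zero, K_inv hb a hβ hu]
  exact mul_neg_of_pos_of_neg (kappa_pos hb a hβ hu) (mass_neg hb a hβ hu)

theorem C_neg : C a b β u < 0 :=
  mul_neg_of_pos_of_neg (kappa_pos hb a hβ hu) (K_neg hb a hβ hu)

theorem rho0_eq (θ : ℝ) : rho0 a b β u θ = C a b β u * profile a b β u θ * (1 / d a b 0 θ) := by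
  rw [rho0, Phi_eq hb a hβ hu, mul_one_div]

theorem rho1_eq (θ : ℝ) :
    rho1 a b β u θ = C a b β u * (1 - profile a b β u θ) * (1 / d a b 1 θ) := by
  rw [rho1, rho0, div_mul_cancel₀ _ (d_neg hb a 0 θ).ne, Phi_eq hb a hβ hu, mul_one_div]
  ring

theorem continuous_rho (i : Fin 2) : Continuous (rho a b β u i) := by
  have hp := continuous_profile hb a hβ hu
  fin_cases i
  · change Continuous (rho0 a b β u)
    rw [funext (rho0_eq hb a hβ hu)]
    exact (continuous_const.mul hp).mul (continuous_inv_d hb a 0)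
  · change Continuous (rho1 a b β u)
    rw [funext (rho1_eq hb a hβ hu)]
    exact (continuous_const.mul (continuous_const.sub hp)).mul (continuous_inv_d hb a 1)

theorem rho_periodic (i : Fin 2) : Function.Periodic (rho a b β u i) (2 * Real.pi) := by
  have hp := profile_periodic (β := β) (u := u) hb a
  intro θ
  fin_cases i
  · change rho0 a b β u _ = rho0 a b β u _
    rw [rho0_eq hb a hβ hu, rho0_eq hb a hβ hu, hp, d_periodic]
  · change rho1 a b β u _ = rho1 a b β u _
    rw [rho1_eq hb a hβ hu, rho1_eq hb a hβ hu, hp, d_periodic]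

theorem rho_pos (i : Fin 2) (θ : ℝ) : 0 < rho a b β u i θ := by
  have hC := C_neg hb a hβ hu
  fin_cases i
  · change 0 < rho0 a b β u θ
    rw [rho0_eq hb a hβ hu]
    exact mul_pos_of_neg_of_neg (mul_neg_of_neg_of_pos hC (profile_pos hb a hβ hu θ))
      (one_div_neg.2 (d_neg hb a 0 θ))
  · change 0 < rho1 a b β u θ
    rw [rho1_eq hb a hβ hu]
    exact mul_pos_of_neg_of_neg (mul_neg_of_neg_of_pos hC
      (sub_pos.2 (profile_lt_one hb a hβ hu θ))) (one_div_neg.2 (d_neg hb a 1 θ))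

theorem integral_rho :
    ∫ θ in (0 : ℝ)..(2 * Real.pi), (rho a b β u 0 θ + rho a b β u 1 θ) = 1 := by
  have h1 : ∀ θ, rho a b β u 0 θ + rho a b β u 1 θ = C a b β u *
      (profile a b β u θ * (1 / d a b 0 θ) + (1 - profile a b β u θ) * (1 / d a b 1 θ)) := by
    intro θ
    change rho0 a b β u θ + rho1 a b β u θ = _
    rw [rho0_eq hb a hβ hu, rho1_eq hb a hβ hu]
    ring
  simp only [h1]
  rw [intervalIntegral.integral_const_mul]
  have h2 := K_inv hb a hβ hu
  have hK := (K_neg hb a hβ hu).ne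
  unfold C
  rw [mul_comm (kappa a b β u), mul_assoc, ← h2, mul_inv_cancel₀ hK]

omit hu in
/-- The stationary Fokker–Planck equation of mode `i`. -/
theorem hasDerivAt_rho_mul_d (i : Fin 2) (θ : ℝ) :
    HasDerivAt (fun x => rho a b β u i x * d a b i x)
      (rate β u (1 - i) * rho a b β u (1 - i) θ - rate β u i * rho a b β u i θ) θ := by
  have h0 := (d_neg hb a 0 θ).ne
  have h1 := (d_neg hb a 1 θ).ne
  have hPhi := hasDerivAt_Phi (β := β) (u := u) hb a θ
  have e0 : ∀ x, rho a b β u 0 x * d a b 0 x = Phi a b β u x := fun x =>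
    div_mul_cancel₀ _ (d_neg hb a 0 x).ne
  have e1 : ∀ x, rho a b β u 1 x * d a b 1 x = C a b β u - Phi a b β u x := fun x => by
    rw [← e0]; exact div_mul_cancel₀ _ (d_neg hb a 1 x).ne
  have key : -β * Phi a b β u θ * (u / d a b 0 θ + (1 - u) / d a b 1 θ) +
      β * C a b β u * (1 - u) / d a b 1 θ =
      rate β u 1 * rho a b β u 1 θ - rate β u 0 * rho a b β u 0 θ := by
    rw [eq_div_of_mul_eq h0 (e0 θ), eq_div_of_mul_eq h1 (e1 θ)]
    simp only [rate, Matrix.cons_val_zero, Matrix.cons_val_one]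
    field_simp
    ring
  fin_cases i
  · change HasDerivAt (fun x => rho a b β u 0 x * d a b 0 x)
      (rate β u 1 * rho a b β u 1 θ - rate β u 0 * rho a b β u 0 θ) θ
    simp only [e0]
    rw [← key]
    exact hPhi
  · change HasDerivAt (fun x => rho a b β u 1 x * d a b 1 x)
      (rate β u 0 * rho a b β u 0 θ - rate β u 1 * rho a b β u 1 θ) θ
    simp only [e1]
    refine (hPhi.const_sub (C a b β u)).congr_deriv ?_
    rw [key]
    ring

end Constants

/-! ### The linear flows -/

/-- `A_i` is the image of `-a + i` under the algebra morphism from `ℂ` to matrices which sends the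
imaginary unit to `!![0, k; -1 / k, 0]`; hence the exponential of `t A_i`. -/
theorem exp_smul_A {b : ℝ} (hb : 0 < b) (a : ℝ) (i : Fin 2) (t : ℝ) :
    NormedSpace.exp (t • A a b i) = Real.exp (-(t * a)) •
      !![Real.cos t, axis b i * Real.sin t; -(1 / axis b i * Real.sin t), Real.cos t] := by
  have hk := (axis_pos hb i).ne'
  set N : Matrix (Fin 2) (Fin 2) ℝ := !![0, axis b i; -(1 / axis b i), 0] with hN
  have hNN : N * N = -1 := by
    rw [hN]
    ext p q
    fin_cases p <;> fin_cases q <;> simp [Matrix.mul_apply, Fin.sum_univ_two, hk]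
  set φ := Complex.liftAux N hNN
  have hφ : Continuous φ := φ.toLinearMap.continuous_of_finiteDimensional
  have hA : t • A a b i = φ ⟨-(t * a), t⟩ := by
    rw [A_eq, Complex.liftAux_apply, hN, Algebra.algebraMap_eq_smul_one]
    ext p q
    fin_cases p <;> fin_cases q <;> simp
  have hexp : NormedSpace.exp (φ ⟨-(t * a), t⟩) = φ (NormedSpace.exp ⟨-(t * a), t⟩) := by
    let _ : NormedRing (Matrix (Fin 2) (Fin 2) ℝ) := Matrix.linftyOpNormedRing
    let _ : NormedAlgebra ℝ (Matrix (Fin 2) (Fin 2) ℝ) := Matrix.linftyOpNormedAlgebra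
    exact (NormedSpace.map_exp φ hφ _).symm
  rw [hA, hexp, ← Complex.exp_eq_exp_ℂ, Complex.liftAux_apply, Complex.exp_re,
    Complex.exp_im, hN, Algebra.algebraMap_eq_smul_one]
  ext p q
  fin_cases p <;> fin_cases q <;> simp <;> ring

/-- The angular flow of mode `i`. -/
noncomputable def flow (a b : ℝ) (i : Fin 2) (t : ℝ) (θ : Real.Angle) : Real.Angle :=
  polarAngle (Matrix.mulVec (NormedSpace.exp (t • A a b i)) ![θ.cos, θ.sin])

theorem polarAngle_smul {c : ℝ} (hc : 0 < c) (x : Fin 2 → ℝ) :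
    polarAngle (c • x) = polarAngle x := by
  have := Complex.arg_real_mul ⟨x 0, x 1⟩ hc
  unfold polarAngle
  rw [← this]
  congr 2
  apply Complex.ext <;> simp

theorem polarAngle_cos_sin (θ : Real.Angle) : polarAngle ![θ.cos, θ.sin] = θ := by
  have := Complex.arg_mul_cos_add_sin_mul_I_coe_angle one_pos θ
  unfold polarAngle
  conv_rhs => rw [← this]
  congr 2
  apply Complex.ext <;> simp

/-- In the coordinate `s` with `θ = ellipseAngle k s`, the linear flow rotates by `-t`. -/
theorem exp_mulVec_ellipse {b : ℝ} (hb : 0 < b) (a : ℝ) (i : Fin 2) (t s : ℝ) :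
    ∃ c : ℝ, 0 < c ∧ Matrix.mulVec (NormedSpace.exp (t • A a b i))
        ![Real.cos (ellipseAngle (axis b i) s), Real.sin (ellipseAngle (axis b i) s)] =
      c • ![Real.cos (ellipseAngle (axis b i) (s - t)),
        Real.sin (ellipseAngle (axis b i) (s - t))] := by
  have hk := axis_pos hb i
  obtain ⟨h1, h2⟩ := ellipse_polar hk s
  obtain ⟨h3, h4⟩ := ellipse_polar hk (s - t)
  have hr := Real.sqrt_pos.2 (ellipse_pos hk s)
  have hr' := Real.sqrt_pos.2 (ellipse_pos hk (s - t))
  set r := Real.sqrt (axis b i ^ 2 * Real.cos s ^ 2 + Real.sin s ^ 2)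
  set r' := Real.sqrt (axis b i ^ 2 * Real.cos (s - t) ^ 2 + Real.sin (s - t) ^ 2)
  refine ⟨Real.exp (-(t * a)) * r' / r, by positivity, ?_⟩
  have e1 := eq_div_of_mul_eq hr.ne' ((mul_comm _ _).trans h1.symm)
  have e2 := eq_div_of_mul_eq hr.ne' ((mul_comm _ _).trans h2.symm)
  have e3 := eq_div_of_mul_eq hr'.ne' ((mul_comm _ _).trans h3.symm)
  have e4 := eq_div_of_mul_eq hr'.ne' ((mul_comm _ _).trans h4.symm)
  rw [e1, e2, e3, e4, exp_smul_A hb, Real.cos_sub, Real.sin_sub]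
  ext p
  fin_cases p <;> simp [Matrix.mulVec, dotProduct, Fin.sum_univ_two] <;> field_simp
  ring

theorem flow_ellipseAngle {b : ℝ} (hb : 0 < b) (a : ℝ) (i : Fin 2) (t s : ℝ) :
    flow a b i t (ellipseAngle (axis b i) s : ℝ) = (ellipseAngle (axis b i) (s - t) : ℝ) := by
  obtain ⟨c, hc, h⟩ := exp_mulVec_ellipse hb a i t s
  rw [flow, Real.Angle.cos_coe, Real.Angle.sin_coe, h, polarAngle_smul hc,
    ← Real.Angle.cos_coe, ← Real.Angle.sin_coe, polarAngle_cos_sin]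

theorem exp_mulVec_eq_flow {b : ℝ} (hb : 0 < b) (a : ℝ) (i : Fin 2) (t : ℝ) (θ : Real.Angle) :
    ∃ c : ℝ, 0 < c ∧ Matrix.mulVec (NormedSpace.exp (t • A a b i)) ![θ.cos, θ.sin] =
      c • ![(flow a b i t θ).cos, (flow a b i t θ).sin] := by
  induction θ using Real.Angle.induction_on with | _ θ
  obtain ⟨s, rfl⟩ := surjective_ellipseAngle (axis_pos hb i) θ
  rw [flow_ellipseAngle hb]
  exact exp_mulVec_ellipse hb a i t s

/-! ### First jump decomposition of the paths -/

theorem modeAfter_succ (i : Fin 2) (n : ℕ) : modeAfter i (n + 1) = modeAfter (1 - i) n := by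
  induction n with
  | zero => rfl
  | succ n ih => rw [modeAfter, ih, modeAfter]

/-- The sequence of clocks `x, ω 0, ω 1, …`. -/
def consClock (p : ℝ × (ℕ → ℝ)) : ℕ → ℝ
  | 0 => p.1
  | n + 1 => p.2 n

theorem rate_pos {β u : ℝ} (hβ : 0 < β) (hu : u ∈ Set.Ioo (0 : ℝ) 1) (i : Fin 2) :
    0 < rate β u i := by
  have := sub_pos.2 hu.2
  have := hu.1
  fin_cases i
  · change 0 < β * u
    positivity
  · change 0 < β * (1 - u)
    positivity

theorem rate_le {β u : ℝ} (hβ : 0 < β) (hu : u ∈ Set.Ioo (0 : ℝ) 1) (i : Fin 2) :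
    rate β u i ≤ β := by
  have := hu.1
  have := hu.2
  fin_cases i
  · change β * u ≤ β
    nlinarith
  · change β * (1 - u) ≤ β
    nlinarith

section Paths

variable (a b β u : ℝ) (x : Fin 2 → ℝ) (i : Fin 2) (p : ℝ × (ℕ → ℝ)) (n : ℕ)

theorem holdingTime_consClock_zero : holdingTime β u i (consClock p) 0 = p.1 / rate β u i := rfl

theorem holdingTime_consClock_succ :
    holdingTime β u i (consClock p) (n + 1) = holdingTime β u (1 - i) p.2 n := by
  rw [holdingTime, holdingTime, modeAfter_succ, consClock]

theorem jumpTime_consClock_succ :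
    jumpTime β u i (consClock p) (n + 1) = p.1 / rate β u i + jumpTime β u (1 - i) p.2 n := by
  rw [jumpTime, Finset.sum_range_succ', holdingTime_consClock_zero, add_comm, jumpTime]
  simp only [holdingTime_consClock_succ]

theorem jumpPosition_consClock_succ :
    jumpPosition a b β u x i (consClock p) (n + 1) = jumpPosition a b β u
      (Matrix.mulVec (NormedSpace.exp ((p.1 / rate β u i) • A a b i)) x) (1 - i) p.2 n := by
  induction n with
  | zero => rfl
  | succ n ih =>
    rw [jumpPosition, ih, holdingTime_consClock_succ, modeAfter_succ, jumpPosition]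

theorem jumpPosition_smul (c : ℝ) (ω : ℕ → ℝ) :
    jumpPosition a b β u (c • x) i ω n = c • jumpPosition a b β u x i ω n := by
  induction n with
  | zero => rfl
  | succ n ih => rw [jumpPosition, ih, jumpPosition, Matrix.mulVec_smul]

theorem position_smul (c t : ℝ) (ω : ℕ → ℝ) :
    position a b β u (c • x) i ω t = c • position a b β u x i ω t := by
  rw [position, position, jumpPosition_smul, Matrix.mulVec_smul]

variable {β u} in
theorem jumpTime_mono (hβ : 0 < β) (hu : u ∈ Set.Ioo (0 : ℝ) 1) {ω : ℕ → ℝ} (hω : ∀ n, 0 < ω n) :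
    Monotone (jumpTime β u i ω) := by
  refine monotone_nat_of_le_succ fun n => ?_
  rw [jumpTime, jumpTime, Finset.sum_range_succ]
  exact le_add_of_nonneg_right (div_pos (hω n) (rate_pos hβ hu _)).le

variable {β u} in
theorem jumpCount_eq_zero (hβ : 0 < β) (hu : u ∈ Set.Ioo (0 : ℝ) 1) {ω : ℕ → ℝ}
    (hω : ∀ n, 0 < ω n) {t : ℝ} (ht : t < ω 0 / rate β u i) :
    jumpCount β u i ω t = 0 := by
  have h1 : jumpTime β u i ω 1 = ω 0 / rate β u i := by
    simp [jumpTime, holdingTime, modeAfter]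
  refine Nat.le_zero.1 (csSup_le' fun n hn => ?_)
  by_contra h
  have := jumpTime_mono i hβ hu hω (show 1 ≤ n by omega)
  rw [h1] at this
  exact absurd hn (not_le.2 (ht.trans_le this))

theorem jumpCount_consClock {t : ℝ} (ht : p.1 / rate β u i ≤ t)
    (hbdd : BddAbove {n : ℕ | jumpTime β u (1 - i) p.2 n ≤ t - p.1 / rate β u i}) :
    jumpCount β u i (consClock p) t =
      jumpCount β u (1 - i) p.2 (t - p.1 / rate β u i) + 1 := by
  have hne : {n : ℕ | jumpTime β u (1 - i) p.2 n ≤ t - p.1 / rate β u i}.Nonempty :=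
    ⟨0, by simpa [jumpTime] using ht⟩
  have hmem := Nat.sSup_mem hne hbdd
  refine IsGreatest.csSup_eq ⟨?_, fun n hn => ?_⟩
  · change jumpTime β u i (consClock p) _ ≤ t
    rw [jumpTime_consClock_succ]
    have : jumpTime β u (1 - i) p.2 (jumpCount β u (1 - i) p.2 (t - p.1 / rate β u i)) ≤
      t - p.1 / rate β u i := hmem
    linarith
  · cases n with
    | zero => exact Nat.zero_le _
    | succ n =>
      refine Nat.succ_le_succ (le_csSup (α := ℕ) hbdd ?_)
      change jumpTime β u i (consClock p) (n + 1) ≤ t at hn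
      rw [jumpTime_consClock_succ] at hn
      change jumpTime β u (1 - i) p.2 n ≤ t - p.1 / rate β u i
      linarith

end Paths

theorem angularProcess_of_lt {a b β u : ℝ} (hβ : 0 < β) (hu : u ∈ Set.Ioo (0 : ℝ) 1)
    {ω : ℕ → ℝ} (hω : ∀ n, 0 < ω n) (θ : Real.Angle) (i : Fin 2) {t : ℝ}
    (ht : t < ω 0 / rate β u i) :
    angularProcess a b β u t ((θ, i), ω) = (flow a b i t θ, i) := by
  have h0 := jumpCount_eq_zero i hβ hu hω ht
  simp [angularProcess, position, modeProcess, h0, modeAfter, jumpTime, jumpPosition, flow]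

theorem angularProcess_of_le {a b β u : ℝ} (hb : 0 < b) (θ : Real.Angle) (i : Fin 2)
    (p : ℝ × (ℕ → ℝ)) {t : ℝ} (ht : p.1 / rate β u i ≤ t)
    (hbdd : BddAbove {n : ℕ | jumpTime β u (1 - i) p.2 n ≤ t - p.1 / rate β u i}) :
    angularProcess a b β u t ((θ, i), consClock p) =
      angularProcess a b β u (t - p.1 / rate β u i)
        ((flow a b i (p.1 / rate β u i) θ, 1 - i), p.2) := by
  have h0 := jumpCount_consClock β u i p ht hbdd
  obtain ⟨c, hc, h⟩ := exp_mulVec_eq_flow hb a i (p.1 / rate β u i) θ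
  have hpos : position a b β u ![θ.cos, θ.sin] i (consClock p) t =
      c • position a b β u ![(flow a b i (p.1 / rate β u i) θ).cos,
        (flow a b i (p.1 / rate β u i) θ).sin] (1 - i) p.2 (t - p.1 / rate β u i) := by
    rw [← position_smul, ← h, position, position, modeProcess, modeProcess, h0, modeAfter_succ,
      jumpTime_consClock_succ, jumpPosition_consClock_succ, sub_add_eq_sub_sub]
  simp only [angularProcess]
  rw [hpos, polarAngle_smul hc, modeProcess, h0, modeAfter_succ, modeProcess]

/-! ### The law of the clocks -/

instance : IsProbabilityMeasure (expMeasure 1) := isProbabilityMeasure_expMeasure one_pos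

instance : IsProbabilityMeasure clockLaw := by unfold clockLaw; infer_instance

theorem measurable_consClock : Measurable consClock := by
  refine measurable_pi_iff.2 fun n => ?_
  cases n with
  | zero => exact measurable_fst
  | succ n => exact (measurable_pi_apply n).comp measurable_snd

theorem map_consClock : ((expMeasure 1).prod clockLaw).map consClock = clockLaw := by
  classical
  refine Measure.eq_infinitePi _ fun s t ht => ?_
  obtain ⟨N, hN⟩ : ∃ N, s ⊆ Finset.range (N + 1) := by
    obtain ⟨N, hN⟩ := s.exists_nat_subset_range
    exact ⟨N, hN.trans (Finset.range_mono (Nat.le_succ N))⟩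
  set t' : ℕ → Set ℝ := fun i => if i ∈ s then t i else Set.univ with ht'
  have ht'm : ∀ i, MeasurableSet (t' i) := by
    intro i
    simp only [ht']
    split_ifs
    exacts [ht i, .univ]
  have hpre : consClock ⁻¹' (s : Set ℕ).pi t =
      t' 0 ×ˢ ((Finset.range N : Finset ℕ) : Set ℕ).pi fun n => t' (n + 1) := by
    ext p
    simp only [Set.mem_preimage, Set.mem_pi, Finset.mem_coe, Set.mem_prod, Finset.mem_range]
    constructor
    · intro h
      refine ⟨?_, fun n _ => ?_⟩
      · by_cases h0 : 0 ∈ s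
        · simpa [ht', h0, consClock] using h 0 h0
        · simp [ht', h0]
      · by_cases h0 : n + 1 ∈ s
        · simpa [ht', h0, consClock] using h (n + 1) h0
        · simp [ht', h0]
    · rintro ⟨h1, h2⟩ n hn
      cases n with
      | zero => simpa [ht', hn, consClock] using h1
      | succ n =>
        have := h2 n (by simpa using hN hn)
        simpa [ht', hn, consClock] using this
  rw [Measure.map_apply measurable_consClock (.pi s.countable_toSet fun i _ => ht i), hpre,
    Measure.prod_prod, clockLaw, Measure.infinitePi_pi _ fun i _ => ht'm _,
    mul_comm, ← Finset.prod_range_succ' (fun i => (expMeasure 1) (t' i)) N,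
    ← Finset.prod_subset hN]
  · exact Finset.prod_congr rfl fun i hi => by simp [ht', hi]
  · intro i _ hi
    simp [ht', hi]

theorem map_div_expMeasure {r : ℝ} (hr : 0 < r) :
    (expMeasure 1).map (fun x => x / r) = expMeasure r := by
  have := isProbabilityMeasure_expMeasure hr
  have hm : Measurable fun x : ℝ => x / r := measurable_id.div_const r
  have := Measure.isProbabilityMeasure_map (μ := expMeasure 1) hm.aemeasurable
  refine Measure.ext_of_Iic _ _ fun y => ?_
  rw [Measure.map_apply hm measurableSet_Iic]
  have h1 : (fun x : ℝ => x / r) ⁻¹' Set.Iic y = Set.Iic (r * y) := by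
    ext x
    simp [div_le_iff₀ hr, mul_comm]
  rw [h1, ← ofReal_cdf, ← ofReal_cdf, cdf_expMeasure_eq one_pos, cdf_expMeasure_eq hr, one_mul]
  simp only [mul_nonneg_iff_of_pos_left hr]

theorem expMeasure_Iic {r : ℝ} (hr : 0 < r) {x : ℝ} (hx : 0 ≤ x) :
    expMeasure r (Set.Iic x) = ENNReal.ofReal (1 - Real.exp (-(r * x))) := by
  have := isProbabilityMeasure_expMeasure hr
  rw [← ofReal_cdf, cdf_expMeasure_eq hr, if_pos hx]

theorem expMeasure_Ioi {r : ℝ} (hr : 0 < r) {x : ℝ} (hx : 0 ≤ x) :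
    expMeasure r (Set.Ioi x) = ENNReal.ofReal (Real.exp (-(r * x))) := by
  have := isProbabilityMeasure_expMeasure hr
  rw [← Set.compl_Iic, prob_compl_eq_one_sub measurableSet_Iic, expMeasure_Iic hr hx,
    ← ENNReal.ofReal_one, ← ENNReal.ofReal_sub _ (by simp; positivity)]
  congr 1
  ring

theorem ae_expMeasure_pos {r : ℝ} (hr : 0 < r) : ∀ᵐ x ∂expMeasure r, 0 < x := by
  have := expMeasure_Iic hr le_rfl
  rw [mul_zero, neg_zero, Real.exp_zero, sub_self, ENNReal.ofReal_zero] at this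
  rw [ae_iff]
  simp only [not_lt]
  exact this

theorem ae_clockLaw_pos : ∀ᵐ ω ∂clockLaw, ∀ n, 0 < ω n := by
  refine ae_all_iff.2 fun n => ?_
  exact (measurePreserving_eval_infinitePi (fun _ : ℕ => expMeasure 1) n).quasiMeasurePreserving.ae
    (ae_expMeasure_pos one_pos)

theorem ae_clockLaw_frequently : ∀ᵐ ω ∂clockLaw, ∃ᶠ n in Filter.atTop, 1 < ω n := by
  have hind : iIndepFun (fun (n : ℕ) (ω : ℕ → ℝ) => ω n) clockLaw :=
    iIndepFun_infinitePi (P := fun _ : ℕ => expMeasure 1) (X := fun _ x => x)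
      fun _ => measurable_id
  have hset : iIndepSet (fun n : ℕ => {ω : ℕ → ℝ | 1 < ω n}) clockLaw :=
    iIndepSet_iff_meas_biInter (fun n => measurable_pi_apply n measurableSet_Ioi) |>.2 fun s =>
      hind.meas_biInter fun n _ => ⟨Set.Ioi 1, measurableSet_Ioi, rfl⟩
  have hval : ∀ n : ℕ, clockLaw {ω : ℕ → ℝ | 1 < ω n} = ENNReal.ofReal (Real.exp (-(1 * 1))) :=
    fun n => by
      rw [← expMeasure_Ioi one_pos zero_le_one]
      exact (measurePreserving_eval_infinitePi (fun _ : ℕ => expMeasure 1) n).measure_preimage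
        measurableSet_Ioi.nullMeasurableSet
  have h1 := measure_limsup_eq_one (s := fun n : ℕ => {ω : ℕ → ℝ | 1 < ω n})
    (fun n => measurable_pi_apply n measurableSet_Ioi) hset (by
    simp only [hval]
    exact ENNReal.tsum_const_eq_top_of_ne_zero (by simp [Real.exp_pos]))
  have h2 := (prob_compl_eq_zero_iff (.measurableSet_limsup fun n =>
    measurable_pi_apply n measurableSet_Ioi)).2 h1
  rw [ae_iff]
  convert h2 using 2
  ext ω
  simp [Filter.mem_limsup_iff_frequently_mem]

/-- Almost surely the jump times do not accumulate. -/
theorem ae_bddAbove_jumpTime {β u : ℝ} (hβ : 0 < β) (hu : u ∈ Set.Ioo (0 : ℝ) 1) :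
    ∀ᵐ ω ∂clockLaw, ∀ (i : Fin 2) (t : ℝ), BddAbove {n : ℕ | jumpTime β u i ω n ≤ t} := by
  filter_upwards [ae_clockLaw_pos, ae_clockLaw_frequently] with ω hω hfr i t
  have hnn : ∀ n, 0 ≤ holdingTime β u i ω n := fun n => (div_pos (hω n) (rate_pos hβ hu _)).le
  have hns : ¬ Summable (holdingTime β u i ω) := by
    intro hs
    have h0 := hs.tendsto_atTop_zero.eventually_lt_const (show 0 < 1 / β by positivity)
    obtain ⟨n, h1, h2⟩ := (hfr.and_eventually h0).exists
    refine absurd h2 (not_lt.2 ?_)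
    exact div_le_div₀ (hω n).le h1.le (rate_pos hβ hu _) (rate_le hβ hu _)
  have htop := (not_summable_iff_tendsto_nat_atTop_of_nonneg hnn).1 hns
  obtain ⟨N, hN⟩ := (htop.eventually_gt_atTop t).exists_forall_of_atTop
  refine ⟨N, fun n hn => ?_⟩
  by_contra h
  exact absurd hn (not_le.2 (hN n (not_le.1 h).le))

/-! ### Measurability of the process -/

theorem measurable_exp_mulVec {α : Type*} [MeasurableSpace α] {b : ℝ} (hb : 0 < b) (a : ℝ)
    (i : Fin 2) {f : α → ℝ} {g : α → Fin 2 → ℝ} (hf : Measurable f) (hg : Measurable g) :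
    Measurable fun x => Matrix.mulVec (NormedSpace.exp (f x • A a b i)) (g x) := by
  have hg' := measurable_pi_iff.1 hg
  refine measurable_pi_iff.2 fun p => ?_
  simp only [exp_smul_A hb]
  have h0 := hg' 0
  have h1 := hg' 1
  fin_cases p <;> simp [Matrix.mulVec, dotProduct, Fin.sum_univ_two] <;> fun_prop

theorem measurable_polarAngle : Measurable polarAngle := by
  have h1 : Measurable fun x : Fin 2 → ℝ => (⟨x 0, x 1⟩ : ℂ) := by
    have h : Measurable fun x : Fin 2 → ℝ => ((x 0 : ℂ) + (x 1 : ℂ) * Complex.I) := by fun_prop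
    simpa only [Complex.mk_eq_add_mul_I] using h
  exact Real.Angle.continuous_coe.measurable.comp (Complex.measurable_arg.comp h1)

theorem measurable_cos_sin : Measurable fun θ : Real.Angle => ![θ.cos, θ.sin] := by
  refine measurable_pi_iff.2 fun p => ?_
  fin_cases p
  · exact Real.Angle.continuous_cos.measurable
  · exact Real.Angle.continuous_sin.measurable

theorem measurable_flow {b : ℝ} (hb : 0 < b) (a : ℝ) (i : Fin 2) :
    Measurable fun q : ℝ × Real.Angle => flow a b i q.1 q.2 :=
  measurable_polarAngle.comp (measurable_exp_mulVec hb a i measurable_fst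
    (measurable_cos_sin.comp measurable_snd))

theorem measurable_holdingTime (β u : ℝ) (i : Fin 2) (n : ℕ) :
    Measurable fun ω => holdingTime β u i ω n :=
  (measurable_pi_apply n).div_const _

theorem measurable_jumpTime (β u : ℝ) (i : Fin 2) (n : ℕ) :
    Measurable fun ω => jumpTime β u i ω n :=
  Finset.measurable_sum _ fun k _ => measurable_holdingTime β u i k

theorem measurable_jumpPosition {b : ℝ} (hb : 0 < b) (a β u : ℝ) (i : Fin 2) (n : ℕ) :
    Measurable fun q : Real.Angle × (ℕ → ℝ) =>
      jumpPosition a b β u ![q.1.cos, q.1.sin] i q.2 n := by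
  induction n with
  | zero => exact measurable_cos_sin.comp measurable_fst
  | succ n ih =>
    exact measurable_exp_mulVec hb a _ ((measurable_holdingTime β u i n).comp measurable_snd) ih

theorem sSup_eq_iSup_ite (S : Set ℕ) [DecidablePred (· ∈ S)] :
    sSup S = ⨆ n, if n ∈ S then n else 0 := by
  by_cases hS : BddAbove S
  · have hb : BddAbove (Set.range fun n => if n ∈ S then n else 0) := by
      obtain ⟨N, hN⟩ := hS
      refine ⟨N, ?_⟩
      rintro _ ⟨n, rfl⟩
      dsimp only
      split_ifs with h
      exacts [hN h, Nat.zero_le _]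
    refine le_antisymm (csSup_le' fun n hn => ?_) (ciSup_le fun n => ?_)
    · simpa [hn] using le_ciSup hb n
    · split_ifs with h
      exacts [le_csSup hS h, Nat.zero_le _]
  · rw [Nat.sSup_of_not_bddAbove hS, iSup, Nat.sSup_of_not_bddAbove]
    rintro ⟨N, hN⟩
    refine hS ⟨N, fun n hn => ?_⟩
    simpa [hn] using hN ⟨n, rfl⟩

theorem measurable_jumpCount (β u : ℝ) (i : Fin 2) :
    Measurable fun q : ℝ × (ℕ → ℝ) => jumpCount β u i q.2 q.1 := by
  classical
  simp only [jumpCount, sSup_eq_iSup_ite]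
  refine Measurable.iSup fun n => ?_
  refine Measurable.ite ?_ measurable_const measurable_const
  exact measurableSet_le ((measurable_jumpTime β u i n).comp measurable_snd) measurable_fst

theorem measurable_of_countable_index {α ι γ : Type*} [MeasurableSpace α] [MeasurableSpace ι]
    [MeasurableSpace γ] [Countable ι] [MeasurableSingletonClass ι] {N : α → ι}
    (hN : Measurable N) {g : ι → α → γ} (hg : ∀ i, Measurable (g i)) :
    Measurable fun x => g (N x) x := by
  have h : Measurable fun p : α × ι => g p.2 p.1 := measurable_from_prod_countable_left hg
  exact h.comp (measurable_id.prodMk hN)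

/-- The angular process on the event that its initial mode is `y.1` and that it has jumped `y.2`
times. -/
noncomputable def angularAfter (a b β u : ℝ) (y : Fin 2 × ℕ) (t : ℝ) (θ : Real.Angle)
    (ω : ℕ → ℝ) : Real.Angle × Fin 2 :=
  (polarAngle (Matrix.mulVec
    (NormedSpace.exp ((t - jumpTime β u y.1 ω y.2) • A a b (modeAfter y.1 y.2)))
    (jumpPosition a b β u ![θ.cos, θ.sin] y.1 ω y.2)), modeAfter y.1 y.2)

theorem angularProcess_eq_angularAfter (a b β u t : ℝ) (z : Real.Angle × Fin 2) (ω : ℕ → ℝ) :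
    angularProcess a b β u t (z, ω) =
      angularAfter a b β u (z.2, jumpCount β u z.2 ω t) t z.1 ω := by
  simp only [angularProcess, position, modeProcess, angularAfter]

theorem measurable_angularAfter {b : ℝ} (hb : 0 < b) (a β u : ℝ) (y : Fin 2 × ℕ) :
    Measurable fun q : ℝ × (Real.Angle × Fin 2) × (ℕ → ℝ) =>
      angularAfter a b β u y q.1 q.2.1.1 q.2.2 := by
  have e1 : Measurable fun q : ℝ × (Real.Angle × Fin 2) × (ℕ → ℝ) =>
      q.1 - jumpTime β u y.1 q.2.2 y.2 :=
    measurable_fst.sub ((measurable_jumpTime β u y.1 y.2).comp (measurable_snd.comp measurable_snd))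
  have e2 := (measurable_jumpPosition hb a β u y.1 y.2).comp
    (show Measurable fun q : ℝ × (Real.Angle × Fin 2) × (ℕ → ℝ) => (q.2.1.1, q.2.2) by fun_prop)
  exact (measurable_polarAngle.comp
    (measurable_exp_mulVec hb a (modeAfter y.1 y.2) e1 e2)).prodMk measurable_const

theorem measurable_angularProcess_uncurry {b : ℝ} (hb : 0 < b) (a β u : ℝ) :
    Measurable fun q : ℝ × (Real.Angle × Fin 2) × (ℕ → ℝ) =>
      angularProcess a b β u q.1 (q.2.1, q.2.2) := by
  simp only [angularProcess_eq_angularAfter]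
  have hi : Measurable fun q : ℝ × (Real.Angle × Fin 2) × (ℕ → ℝ) => q.2.1.2 := by fun_prop
  have hp : Measurable fun q : ℝ × (Real.Angle × Fin 2) × (ℕ → ℝ) => (q.1, q.2.2) := by fun_prop
  have hc : Measurable fun q : ℝ × (Real.Angle × Fin 2) × (ℕ → ℝ) =>
      jumpCount β u q.2.1.2 q.2.2 q.1 :=
    measurable_of_countable_index hi (g := fun i q => jumpCount β u i q.2.2 q.1) fun i => by
      have h := (measurable_jumpCount β u i).comp hp
      exact h
  exact measurable_of_countable_index (hi.prodMk hc)
    (g := fun y q => angularAfter a b β u y q.1 q.2.1.1 q.2.2)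
    fun y => measurable_angularAfter hb a β u y

theorem measurable_angularProcess_comp {α : Type*} [MeasurableSpace α] {b : ℝ} (hb : 0 < b)
    (a β u : ℝ) {f : α → ℝ} {g : α → Real.Angle × Fin 2} {h : α → ℕ → ℝ} (hf : Measurable f)
    (hg : Measurable g) (hh : Measurable h) :
    Measurable fun x => angularProcess a b β u (f x) (g x, h x) := by
  have h := (measurable_angularProcess_uncurry hb a β u).comp (hf.prodMk (hg.prodMk hh))
  exact h

theorem _root_.Measurable.angularFlow {α : Type*} [MeasurableSpace α] {b : ℝ} (hb : 0 < b)
    (a : ℝ) {f : α → ℝ} {i : α → Fin 2} {g : α → Real.Angle} (hf : Measurable f)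
    (hi : Measurable i) (hg : Measurable g) :
    Measurable fun x => flow a b (i x) (f x) (g x) :=
  measurable_of_countable_index hi (g := fun i x => flow a b i (f x) (g x)) fun i => by
    have h := (measurable_flow hb a i).comp (hf.prodMk hg)
    exact h

/-! ### The renewal equation at the first jump -/

section Renewal

variable {b β u : ℝ} (hb : 0 < b) (a : ℝ) (hβ : 0 < β) (hu : u ∈ Set.Ioo (0 : ℝ) 1)
include hb hβ hu

theorem ae_angularProcess_consClock (θ : Real.Angle) (i : Fin 2) (t : ℝ) :
    ∀ᵐ p ∂(expMeasure 1).prod clockLaw,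
      angularProcess a b β u t ((θ, i), consClock p) =
        if t < p.1 / rate β u i then (flow a b i t θ, i) else
          angularProcess a b β u (t - p.1 / rate β u i)
            ((flow a b i (p.1 / rate β u i) θ, 1 - i), p.2) := by
  have h1 : ∀ᵐ p ∂(expMeasure 1).prod clockLaw, ∀ n, 0 < consClock p n := by
    have := ae_clockLaw_pos
    rw [← map_consClock] at this
    exact ae_of_ae_map measurable_consClock.aemeasurable this
  have h2 : ∀ᵐ p ∂(expMeasure 1).prod clockLaw, ∀ (i : Fin 2) (t : ℝ),
      BddAbove {n : ℕ | jumpTime β u i p.2 n ≤ t} :=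
    Measure.quasiMeasurePreserving_snd.ae (ae_bddAbove_jumpTime hβ hu)
  filter_upwards [h1, h2] with p hp1 hp2
  split_ifs with h
  · exact angularProcess_of_lt hβ hu hp1 θ i h
  · exact angularProcess_of_le hb θ i p (not_lt.1 h) (hp2 _ _)

omit hβ hu in
theorem measurable_first_jump (θ : Real.Angle) (i : Fin 2) (t : ℝ) :
    Measurable fun p : ℝ × (ℕ → ℝ) => if t < p.1 then (flow a b i t θ, i) else
      angularProcess a b β u (t - p.1) ((flow a b i p.1 θ, 1 - i), p.2) := by
  refine Measurable.ite (measurableSet_lt measurable_const measurable_fst) measurable_const ?_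
  exact measurable_angularProcess_comp hb a β u (by fun_prop)
    ((Measurable.angularFlow hb a measurable_fst measurable_const measurable_const).prodMk
      measurable_const) measurable_snd

/-- Markov property at the first jump, whose date is an exponential variable. -/
theorem map_angularProcess (θ : Real.Angle) (i : Fin 2) (t : ℝ) :
    clockLaw.map (fun ω => angularProcess a b β u t ((θ, i), ω)) =
      ((expMeasure (rate β u i)).prod clockLaw).map (fun p => if t < p.1 then (flow a b i t θ, i)
        else angularProcess a b β u (t - p.1) ((flow a b i p.1 θ, 1 - i), p.2)) := by
  have hr := rate_pos hβ hu i
  have := isProbabilityMeasure_expMeasure hr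
  have hm : Measurable fun x : ℝ => x / rate β u i := measurable_id.div_const _
  have hZ : Measurable fun ω => angularProcess a b β u t ((θ, i), ω) :=
    measurable_angularProcess_comp hb a β u measurable_const measurable_const measurable_id
  have hprod : (expMeasure (rate β u i)).prod clockLaw =
      ((expMeasure 1).prod clockLaw).map (Prod.map (fun x => x / rate β u i) id) := by
    rw [← Measure.map_prod_map _ _ hm measurable_id, map_div_expMeasure hr, Measure.map_id]
  rw [hprod, Measure.map_map (measurable_first_jump hb a θ i t) (hm.prodMap measurable_id)]
  conv_lhs => rw [← map_consClock, Measure.map_map hZ measurable_consClock]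
  exact Measure.map_congr (ae_angularProcess_consClock hb a hβ hu θ i t)

end Renewal

/-- The transition operators of the angular process, on nonnegative functions. -/
noncomputable def transition (a b β u t : ℝ) (f : Real.Angle × Fin 2 → ENNReal)
    (z : Real.Angle × Fin 2) : ENNReal :=
  ∫⁻ ω, f (angularProcess a b β u t (z, ω)) ∂clockLaw

/-- The part of the transition operator which corresponds to the absence of jumps. -/
noncomputable def noJump (a b β u t : ℝ) (f : Real.Angle × Fin 2 → ENNReal)
    (z : Real.Angle × Fin 2) : ENNReal :=
  ENNReal.ofReal (Real.exp (-(rate β u z.2 * t))) * f (flow a b z.2 t z.1, z.2)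

/-- The jump operator. -/
noncomputable def jump (β u : ℝ) (f : Real.Angle × Fin 2 → ENNReal)
    (z : Real.Angle × Fin 2) : ENNReal :=
  ENNReal.ofReal (rate β u z.2) * f (z.1, 1 - z.2)

section Renewal

variable {b β u : ℝ} (hb : 0 < b) (a : ℝ) (hβ : 0 < β) (hu : u ∈ Set.Ioo (0 : ℝ) 1)
include hb

theorem measurable_transition {f : Real.Angle × Fin 2 → ENNReal} (hf : Measurable f) :
    Measurable fun q : ℝ × (Real.Angle × Fin 2) => transition a b β u q.1 f q.2 := by
  have h : Measurable fun p : (ℝ × (Real.Angle × Fin 2)) × (ℕ → ℝ) =>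
      f (angularProcess a b β u p.1.1 (p.1.2, p.2)) :=
    hf.comp (measurable_angularProcess_comp hb a β u (by fun_prop) (by fun_prop) (by fun_prop))
  exact h.lintegral_prod_right'

theorem measurable_noJump {α : Type*} [MeasurableSpace α] {f : α → Real.Angle × Fin 2 → ENNReal}
    (hf : Measurable fun q : α × Real.Angle × Fin 2 => f q.1 q.2) {t : α → ℝ} (ht : Measurable t)
    {z : α → Real.Angle × Fin 2} (hz : Measurable z) :
    Measurable fun x => noJump a b β u (t x) (f x) (z x) := by
  have h1 : Measurable fun x => rate β u (z x).2 :=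
    (measurable_of_finite (rate β u)).comp (measurable_snd.comp hz)
  have h2 := hf.comp (measurable_id.prodMk ((Measurable.angularFlow hb a ht
    (measurable_snd.comp hz) (measurable_fst.comp hz)).prodMk (measurable_snd.comp hz)))
  exact Measurable.mul (by fun_prop) h2

omit hb in
theorem measurable_jump {α : Type*} [MeasurableSpace α] {f : α → Real.Angle × Fin 2 → ENNReal}
    (hf : Measurable fun q : α × Real.Angle × Fin 2 => f q.1 q.2)
    {z : α → Real.Angle × Fin 2} (hz : Measurable z) :
    Measurable fun x => jump β u (f x) (z x) := by
  have h1 : Measurable fun x => rate β u (z x).2 :=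
    (measurable_of_finite (rate β u)).comp (measurable_snd.comp hz)
  have h3 : Measurable fun x => 1 - (z x).2 :=
    (measurable_of_finite fun i : Fin 2 => 1 - i).comp (measurable_snd.comp hz)
  have h2 := hf.comp (measurable_id.prodMk ((measurable_fst.comp hz).prodMk h3))
  exact Measurable.mul (by fun_prop) h2

omit hb in
theorem lintegral_expMeasure_Iic {r : ℝ} (t : ℝ) {g : ℝ → ENNReal}
    (hg : Measurable g) : ∫⁻ s in Set.Iic t, g s ∂expMeasure r =
      ∫⁻ s in Set.Ioc 0 t, ENNReal.ofReal (r * Real.exp (-(r * s))) * g s := by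
  have hpdf : expMeasure r = volume.withDensity (exponentialPDF r) := rfl
  have hpm : Measurable (exponentialPDF r) := (measurable_exponentialPDFReal r).ennreal_ofReal
  rw [hpdf, setLIntegral_withDensity_eq_setLIntegral_mul _ hpm hg measurableSet_Iic,
    setLIntegral_congr (Ioc_ae_eq_Icc (a := (0 : ℝ)) (b := t)),
    ← lintegral_indicator measurableSet_Iic, ← lintegral_indicator measurableSet_Icc]
  refine lintegral_congr fun s => ?_
  by_cases h0 : 0 ≤ s
  · by_cases ht : s ≤ t <;> simp [Set.indicator, h0, ht, exponentialPDF_of_nonneg]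
  · simp [Set.indicator, h0, exponentialPDF_of_neg (not_le.1 h0)]

include hβ hu

theorem transition_eq {f : Real.Angle × Fin 2 → ENNReal} (hf : Measurable f) {t : ℝ} (ht : 0 ≤ t)
    (z : Real.Angle × Fin 2) :
    transition a b β u t f z = noJump a b β u t f z +
      ∫⁻ r in Set.Ioc 0 t, noJump a b β u r (jump β u (transition a b β u (t - r) f)) z := by
  obtain ⟨θ, i⟩ := z
  have hr := rate_pos hβ hu i
  have := isProbabilityMeasure_expMeasure hr
  have hZ : Measurable fun ω => angularProcess a b β u t ((θ, i), ω) :=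
    measurable_angularProcess_comp hb a β u measurable_const measurable_const measurable_id
  have hJ := measurable_first_jump (β := β) (u := u) hb a θ i t
  have htr : Measurable fun s : ℝ =>
      transition a b β u (t - s) f (flow a b i s θ, 1 - i) := by
    have h0 : Measurable fun s : ℝ => (t - s, (flow a b i s θ, 1 - i)) :=
      Measurable.prodMk (by fun_prop) ((Measurable.angularFlow hb a measurable_id
        measurable_const measurable_const).prodMk measurable_const)
    have h := (measurable_transition (β := β) (u := u) hb a hf).comp h0
    exact h
  have hcomp : Measurable fun p : ℝ × (ℕ → ℝ) => f (if t < p.1 then (flow a b i t θ, i) else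
      angularProcess a b β u (t - p.1) ((flow a b i p.1 θ, 1 - i), p.2)) := hf.comp hJ
  rw [transition, ← lintegral_map (μ := clockLaw) hf hZ, map_angularProcess hb a hβ hu,
    lintegral_map hf hJ, lintegral_prod _ hcomp.aemeasurable,
    ← lintegral_add_compl _ (measurableSet_Ioi (a := t)), Set.compl_Ioi]
  congr 1
  · rw [setLIntegral_congr_fun (g := fun _ => f (flow a b i t θ, i)) measurableSet_Ioi]
    · rw [setLIntegral_const, expMeasure_Ioi hr ht, mul_comm]
      rfl
    · intro s hs
      simp [Set.mem_Ioi.1 hs]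
  · rw [setLIntegral_congr_fun (g := fun s =>
      transition a b β u (t - s) f (flow a b i s θ, 1 - i)) measurableSet_Iic]
    · rw [lintegral_expMeasure_Iic t htr]
      refine lintegral_congr fun s => ?_
      rw [noJump, jump, mul_comm (rate β u i), ENNReal.ofReal_mul (Real.exp_pos _).le, mul_assoc]
    · intro s hs
      simp [not_lt.2 (Set.mem_Iic.1 hs), transition]

/-- The renewal equation for bounded real functions. -/
theorem integral_angularProcess {f : Real.Angle × Fin 2 → ℝ} (hf : Measurable f) {M : ℝ}
    (hM : ∀ z, |f z| ≤ M) {t : ℝ} (ht : 0 ≤ t) (θ : Real.Angle) (i : Fin 2) :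
    ∫ ω, f (angularProcess a b β u t ((θ, i), ω)) ∂clockLaw =
      Real.exp (-(rate β u i * t)) * f (flow a b i t θ, i) +
      ∫ s in Set.Iic t, (∫ ω, f (angularProcess a b β u (t - s)
        ((flow a b i s θ, 1 - i), ω)) ∂clockLaw) ∂expMeasure (rate β u i) := by
  have hr := rate_pos hβ hu i
  have := isProbabilityMeasure_expMeasure hr
  have hZ : Measurable fun ω => angularProcess a b β u t ((θ, i), ω) :=
    measurable_angularProcess_comp hb a β u measurable_const measurable_const measurable_id
  have hJ := measurable_first_jump (β := β) (u := u) hb a θ i t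
  have hint : Integrable (fun p : ℝ × (ℕ → ℝ) => f (if t < p.1 then (flow a b i t θ, i) else
      angularProcess a b β u (t - p.1) ((flow a b i p.1 θ, 1 - i), p.2)))
      ((expMeasure (rate β u i)).prod clockLaw) :=
    Integrable.of_bound (hf.comp hJ).aestronglyMeasurable M
      (Filter.Eventually.of_forall fun p => hM _)
  rw [← integral_map (μ := clockLaw) hZ.aemeasurable hf.aestronglyMeasurable,
    map_angularProcess hb a hβ hu,
    integral_map hJ.aemeasurable hf.aestronglyMeasurable, integral_prod _ hint,
    ← integral_add_compl (measurableSet_Ioi (a := t)) hint.integral_prod_left, Set.compl_Ioi]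
  congr 1
  · rw [setIntegral_congr_fun (g := fun _ => f (flow a b i t θ, i)) measurableSet_Ioi]
    · rw [setIntegral_const, measureReal_def, expMeasure_Ioi hr ht,
        ENNReal.toReal_ofReal (Real.exp_pos _).le, smul_eq_mul]
    · intro s hs
      simp [Set.mem_Ioi.1 hs]
  · refine setIntegral_congr_fun measurableSet_Iic fun s hs => ?_
    simp [not_lt.2 (Set.mem_Iic.1 hs)]

end Renewal

/-! ### Invariance of the explicit density -/

theorem lintegral_ellipse {k : ℝ} (hk : 0 < k) (G : ℝ → ENNReal) :
    ∫⁻ θ in Set.Ioc 0 (2 * Real.pi), G θ = ∫⁻ s in Set.Ioc 0 (2 * Real.pi),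
      ENNReal.ofReal (ellipseSpeed k s) * G (ellipseAngle k s) := by
  have hmono := strictMono_ellipseAngle hk
  have h2 : ellipseAngle k (2 * Real.pi) = 2 * Real.pi := by
    have := ellipseAngle_add_two_pi hk 0
    simpa using this
  have himg : ellipseAngle k '' Set.Ioc 0 (2 * Real.pi) = Set.Ioc 0 (2 * Real.pi) := by
    ext y
    constructor
    · rintro ⟨x, hx, rfl⟩
      refine ⟨?_, ?_⟩
      · simpa using hmono hx.1
      · simpa [h2] using hmono.monotone hx.2
    · intro hy
      obtain ⟨x, rfl⟩ := surjective_ellipseAngle hk y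
      refine ⟨x, ⟨hmono.lt_iff_lt.1 (by simpa using hy.1), hmono.le_iff_le.1 ?_⟩, rfl⟩
      simpa [h2] using hy.2
  have h := lintegral_image_eq_lintegral_abs_deriv_mul (s := Set.Ioc 0 (2 * Real.pi))
    measurableSet_Ioc (fun x _ => (hasDerivAt_ellipseAngle hk x).hasDerivWithinAt)
    hmono.injective.injOn G
  rw [himg] at h
  rw [h]
  simp only [abs_of_pos (ellipseSpeed_pos hk _)]

theorem lintegral_periodic_sub {G : ℝ → ENNReal} (hG : Function.Periodic G (2 * Real.pi)) (r : ℝ) :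
    ∫⁻ s in Set.Ioc 0 (2 * Real.pi), G (s - r) = ∫⁻ s in Set.Ioc 0 (2 * Real.pi), G s := by
  have h1 := (measurePreserving_sub_right volume r).setLIntegral_comp_preimage_emb
    (measurableEmbedding_subRight r) G (Set.Ioc (0 - r) (2 * Real.pi - r))
  rw [Set.preimage_sub_const_Ioc, sub_add_cancel, sub_add_cancel] at h1
  rw [h1, zero_sub, show 2 * Real.pi - r = -r + 2 * Real.pi by ring]
  have h2 := isAddFundamentalDomain_Ioc Real.two_pi_pos (-r) volume
  have h3 := isAddFundamentalDomain_Ioc Real.two_pi_pos 0 volume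
  rw [zero_add] at h3
  refine h2.setLIntegral_eq h3 G fun g x => ?_
  obtain ⟨n, hn⟩ := AddSubgroup.mem_zmultiples_iff.1 g.2
  rw [AddSubgroup.vadd_def, ← hn, vadd_eq_add, add_comm]
  exact hG.zsmul n x

theorem lintegral_densityMeasure {ρ : Fin 2 → ℝ → ℝ} (hρ : ∀ i, Measurable (ρ i))
    {F : Real.Angle × Fin 2 → ENNReal} (hF : Measurable F) :
    ∫⁻ z, F z ∂densityMeasure ρ = ∑ i, ∫⁻ θ in Set.Ioc 0 (2 * Real.pi),
      ENNReal.ofReal (ρ i θ) * F ((θ : Real.Angle), i) := by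
  have hc : ∀ i : Fin 2, Measurable fun θ : ℝ => ((θ : Real.Angle), i) := fun i =>
    Real.Angle.continuous_coe.measurable.prodMk measurable_const
  rw [densityMeasure, lintegral_finsetSum_measure]
  refine Finset.sum_congr rfl fun i _ => ?_
  rw [lintegral_map hF (hc i)]
  exact lintegral_withDensity_eq_lintegral_mul _ (hρ i).ennreal_ofReal (hF.comp (hc i))

/-- The density in mode `j`, read in the coordinate `s` which rectifies the flow of mode `i`. -/
noncomputable def ellipseDensity (a b β u : ℝ) (i j : Fin 2) (s : ℝ) : ℝ :=
  rho a b β u j (ellipseAngle (axis b i) s) * ellipseSpeed (axis b i) s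

section Invariance

variable {b β u : ℝ} (hb : 0 < b) (a : ℝ) (hβ : 0 < β) (hu : u ∈ Set.Ioo (0 : ℝ) 1)
include hb hβ hu

theorem continuous_ellipseDensity (i j : Fin 2) : Continuous (ellipseDensity a b β u i j) :=
  ((continuous_rho hb a hβ hu j).comp (continuous_ellipseAngle (axis_pos hb i))).mul
    (continuous_ellipseSpeed (axis_pos hb i))

theorem ellipseDensity_pos (i j : Fin 2) (s : ℝ) : 0 < ellipseDensity a b β u i j s :=
  mul_pos (rho_pos hb a hβ hu j _) (ellipseSpeed_pos (axis_pos hb i) s)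

theorem ellipseDensity_periodic (i j : Fin 2) :
    Function.Periodic (ellipseDensity a b β u i j) (2 * Real.pi) := by
  intro s
  have hsp : ellipseSpeed (axis b i) (s + 2 * Real.pi) = ellipseSpeed (axis b i) s := by
    rw [two_mul, ← add_assoc, ellipseSpeed_add_pi, ellipseSpeed_add_pi]
  rw [ellipseDensity, ellipseAngle_add_two_pi (axis_pos hb i), rho_periodic hb a hβ hu, hsp,
    ellipseDensity]

omit hu in
theorem hasDerivAt_ellipseDensity (i : Fin 2) (s : ℝ) :
    HasDerivAt (ellipseDensity a b β u i i) (rate β u i * ellipseDensity a b β u i i s -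
      rate β u (1 - i) * ellipseDensity a b β u i (1 - i) s) s := by
  have h := ((hasDerivAt_rho_mul_d (u := u) hb a hβ i (ellipseAngle (axis b i) s)).comp s
    (hasDerivAt_ellipseAngle (axis_pos hb i) s)).neg
  have heq : ellipseDensity a b β u i i =
      -((fun x => rho a b β u i x * d a b i x) ∘ ellipseAngle (axis b i)) := by
    ext x
    simp [ellipseDensity, ellipseSpeed_eq_neg_d hb a]
  rw [heq]
  refine h.congr_deriv ?_
  rw [← heq, ellipseDensity, ellipseDensity]
  ring

/-- Variation of constants along the flow of mode `i`. -/
theorem ellipseDensity_eq (i : Fin 2) (s : ℝ) {r : ℝ} (hr : 0 ≤ r) :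
    ENNReal.ofReal (ellipseDensity a b β u i i s) =
      ENNReal.ofReal (Real.exp (-(rate β u i * r)) * ellipseDensity a b β u i i (s + r)) +
      ∫⁻ q in Set.Ioc 0 r, ENNReal.ofReal (Real.exp (-(rate β u i * q)) *
        (rate β u (1 - i) * ellipseDensity a b β u i (1 - i) (s + q))) := by
  have hD : ∀ q, HasDerivAt
      (fun q => -(Real.exp (-(rate β u i * q)) * ellipseDensity a b β u i i (s + q)))
      (Real.exp (-(rate β u i * q)) *
        (rate β u (1 - i) * ellipseDensity a b β u i (1 - i) (s + q))) q := by
    intro q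
    have h1 := ((hasDerivAt_id q).const_mul (rate β u i)).neg.exp
    have h2 := (hasDerivAt_ellipseDensity (u := u) hb a hβ i (s + q)).comp_const_add s q
    refine ((h1.mul h2).neg).congr_deriv ?_
    simp
    ring
  have hcont : Continuous fun q => Real.exp (-(rate β u i * q)) *
      (rate β u (1 - i) * ellipseDensity a b β u i (1 - i) (s + q)) := by
    have := continuous_ellipseDensity hb a hβ hu i (1 - i)
    fun_prop
  have hnn : ∀ q, 0 ≤ Real.exp (-(rate β u i * q)) *
      (rate β u (1 - i) * ellipseDensity a b β u i (1 - i) (s + q)) := fun q =>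
    (mul_pos (Real.exp_pos _) (mul_pos (rate_pos hβ hu _)
      (ellipseDensity_pos hb a hβ hu _ _ _))).le
  rw [← ofReal_integral_eq_lintegral_ofReal
      (hcont.integrableOn_Ioc) (Filter.Eventually.of_forall hnn),
    ← intervalIntegral.integral_of_le hr,
    intervalIntegral.integral_eq_sub_of_hasDerivAt (fun q _ => hD q)
      (hcont.intervalIntegrable _ _), ← ENNReal.ofReal_add
      (mul_pos (Real.exp_pos _) (ellipseDensity_pos hb a hβ hu _ _ _)).le]
  · congr 1
    simp
  · have := intervalIntegral.integral_nonneg (μ := volume) hr fun q _ => hnn q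
    rwa [intervalIntegral.integral_eq_sub_of_hasDerivAt (fun q _ => hD q)
      (hcont.intervalIntegrable _ _)] at this

theorem lintegral_eq_ellipse {F : Real.Angle × Fin 2 → ENNReal} (hF : Measurable F) :
    ∫⁻ z, F z ∂densityMeasure (rho a b β u) = ∑ i, ∫⁻ s in Set.Ioc 0 (2 * Real.pi),
      ENNReal.ofReal (ellipseDensity a b β u i i s) *
        F ((ellipseAngle (axis b i) s : ℝ), i) := by
  rw [lintegral_densityMeasure (fun i => (continuous_rho hb a hβ hu i).measurable) hF]
  refine Finset.sum_congr rfl fun i _ => ?_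
  rw [lintegral_ellipse (axis_pos hb i)]
  refine lintegral_congr fun s => ?_
  rw [ellipseDensity, mul_comm (rho _ _ _ _ _ _),
    ENNReal.ofReal_mul (ellipseSpeed_pos (axis_pos hb i) s).le, mul_assoc]

theorem lintegral_jump_eq_ellipse {F : Real.Angle × Fin 2 → ENNReal} (hF : Measurable F) :
    ∫⁻ z, jump β u F z ∂densityMeasure (rho a b β u) = ∑ i, ∫⁻ s in Set.Ioc 0 (2 * Real.pi),
      ENNReal.ofReal (rate β u (1 - i) * ellipseDensity a b β u i (1 - i) s) *
        F ((ellipseAngle (axis b i) s : ℝ), i) := by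
  have hJ : Measurable (jump β u F) :=
    measurable_jump (f := fun _ : Real.Angle × Fin 2 => F) (hF.comp measurable_snd) measurable_id
  have h1 : ∀ i : Fin 2, ∫⁻ θ in Set.Ioc 0 (2 * Real.pi), ENNReal.ofReal (rho a b β u (1 - i) θ) *
      jump β u F ((θ : Real.Angle), 1 - i) = ∫⁻ s in Set.Ioc 0 (2 * Real.pi),
      ENNReal.ofReal (rate β u (1 - i) * ellipseDensity a b β u i (1 - i) s) *
        F ((ellipseAngle (axis b i) s : ℝ), i) := by
    intro i
    rw [lintegral_ellipse (axis_pos hb i)]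
    refine lintegral_congr fun s => ?_
    rw [ellipseDensity, jump, sub_sub_cancel, mul_comm (rho _ _ _ _ _ _),
      ENNReal.ofReal_mul (rate_pos hβ hu _).le,
      ENNReal.ofReal_mul (ellipseSpeed_pos (axis_pos hb i) s).le]
    ring
  rw [lintegral_densityMeasure (fun i => (continuous_rho hb a hβ hu i).measurable) hJ,
    ← (Equiv.subLeft (1 : Fin 2)).sum_comp]
  exact Finset.sum_congr rfl fun i _ => h1 i

omit hβ hu in
theorem lintegral_noJump_ellipse {f : Real.Angle × Fin 2 → ENNReal} (i : Fin 2) {m : ℝ → ℝ}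
    (hm : Function.Periodic m (2 * Real.pi)) (q : ℝ) :
    ∫⁻ s in Set.Ioc 0 (2 * Real.pi), ENNReal.ofReal (m s) *
        noJump a b β u q f ((ellipseAngle (axis b i) s : ℝ), i) =
      ∫⁻ s in Set.Ioc 0 (2 * Real.pi), ENNReal.ofReal (Real.exp (-(rate β u i * q)) * m (s + q)) *
        f ((ellipseAngle (axis b i) s : ℝ), i) := by
  symm
  rw [← lintegral_periodic_sub (r := q)]
  · refine lintegral_congr fun s => ?_
    rw [noJump, sub_add_cancel, ENNReal.ofReal_mul (Real.exp_pos _).le, flow_ellipseAngle hb]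
    ring
  · intro s
    have h1 : s + 2 * Real.pi + q = s + q + 2 * Real.pi := by ring
    simp only [h1, hm (s + q), ellipseAngle_add_two_pi (axis_pos hb i), Real.Angle.coe_add,
      Real.Angle.coe_two_pi, add_zero]

/-- The Duhamel form of stationarity: it involves the flows rather than their generators. -/
theorem lintegral_duhamel {f : Real.Angle × Fin 2 → ENNReal} (hf : Measurable f) {r : ℝ}
    (hr : 0 ≤ r) :
    ∫⁻ z, f z ∂densityMeasure (rho a b β u) =
      ∫⁻ z, noJump a b β u r f z ∂densityMeasure (rho a b β u) +
      ∫⁻ q in Set.Ioc 0 r, ∫⁻ z, jump β u (noJump a b β u q f) z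
        ∂densityMeasure (rho a b β u) := by
  have hnJ : ∀ q, Measurable (noJump a b β u q f) := fun q =>
    measurable_noJump (f := fun _ : Real.Angle × Fin 2 => f) hb a (hf.comp measurable_snd)
      measurable_const measurable_id
  have hΨ : ∀ i, Measurable fun s : ℝ => f ((ellipseAngle (axis b i) s : ℝ), i) := fun i =>
    hf.comp ((Real.Angle.continuous_coe.comp
      (continuous_ellipseAngle (axis_pos hb i))).measurable.prodMk measurable_const)
  have hDm : ∀ i j, Measurable (ellipseDensity a b β u i j) := fun i j =>
    (continuous_ellipseDensity hb a hβ hu i j).measurable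
  have hper : ∀ i : Fin 2, Function.Periodic
      (fun s => rate β u (1 - i) * ellipseDensity a b β u i (1 - i) s) (2 * Real.pi) :=
      fun i s => by
    simp only [ellipseDensity_periodic hb a hβ hu i (1 - i) s]
  have hmeas : ∀ i : Fin 2, Measurable fun p : ℝ × ℝ =>
      ENNReal.ofReal (Real.exp (-(rate β u i * p.1)) *
        (rate β u (1 - i) * ellipseDensity a b β u i (1 - i) (p.2 + p.1))) *
        f ((ellipseAngle (axis b i) p.2 : ℝ), i) := fun i => by
    have h1 := hΨ i
    have h2 := hDm i (1 - i)
    refine Measurable.mul (by fun_prop) (h1.comp measurable_snd)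
  rw [lintegral_eq_ellipse hb a hβ hu hf, lintegral_eq_ellipse hb a hβ hu (hnJ r)]
  simp only [lintegral_jump_eq_ellipse hb a hβ hu (hnJ _)]
  simp only [lintegral_noJump_ellipse hb a _ (hper _),
    lintegral_noJump_ellipse hb a _ (ellipseDensity_periodic hb a hβ hu _ _)]
  rw [lintegral_finsetSum]
  · rw [← Finset.sum_add_distrib]
    refine Finset.sum_congr rfl fun i _ => ?_
    rw [lintegral_lintegral_swap (hmeas i).aemeasurable, ← lintegral_add_left]
    · refine lintegral_congr fun s => ?_
      rw [lintegral_mul_const, ← add_mul, ← ellipseDensity_eq hb a hβ hu i s hr]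
      have := hDm i (1 - i)
      fun_prop
    · have := hDm i i
      exact Measurable.mul (by fun_prop) (hΨ i)
  · intro i _
    exact (hmeas i).lintegral_prod_right'

theorem isProbabilityMeasure_density :
    IsProbabilityMeasure (densityMeasure (rho a b β u)) := by
  constructor
  have hint : ∀ i, IntegrableOn (rho a b β u i) (Set.Ioc 0 (2 * Real.pi)) := fun i =>
    (continuous_rho hb a hβ hu i).integrableOn_Ioc
  have hnn : ∀ i θ, 0 ≤ rho a b β u i θ := fun i θ => (rho_pos hb a hβ hu i θ).le
  rw [← lintegral_one, lintegral_densityMeasure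
    (fun i => (continuous_rho hb a hβ hu i).measurable) measurable_const]
  simp only [mul_one]
  rw [Fin.sum_univ_two, ← ofReal_integral_eq_lintegral_ofReal (hint 0) (ae_of_all _ (hnn 0)),
    ← ofReal_integral_eq_lintegral_ofReal (hint 1) (ae_of_all _ (hnn 1)),
    ← ENNReal.ofReal_add (integral_nonneg (hnn 0)) (integral_nonneg (hnn 1)),
    ← integral_add (hint 0) (hint 1), ← intervalIntegral.integral_of_le Real.two_pi_pos.le,
    integral_rho hb a hβ hu, ENNReal.ofReal_one]

omit hb in
theorem noJump_le {f : Real.Angle × Fin 2 → ENNReal} {M : ENNReal} (hf : ∀ z, f z ≤ M) {t : ℝ}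
    (ht : 0 ≤ t) (z : Real.Angle × Fin 2) : noJump a b β u t f z ≤ M := by
  have h : ENNReal.ofReal (Real.exp (-(rate β u z.2 * t))) ≤ 1 := by
    rw [ENNReal.ofReal_le_one, Real.exp_le_one_iff, neg_nonpos]
    exact mul_nonneg (rate_pos hβ hu _).le ht
  calc noJump a b β u t f z ≤ 1 * M := mul_le_mul' h (hf _)
    _ = M := one_mul M

omit hb in
theorem jump_le {f : Real.Angle × Fin 2 → ENNReal} {M : ENNReal} (hf : ∀ z, f z ≤ M)
    (z : Real.Angle × Fin 2) : jump β u f z ≤ ENNReal.ofReal β * M :=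
  mul_le_mul' (ENNReal.ofReal_le_ofReal (rate_le hβ hu _)) (hf _)

omit hβ hu in
theorem measurable_transition_comp {α : Type*} [MeasurableSpace α]
    {f : Real.Angle × Fin 2 → ENNReal} (hf : Measurable f) {p : α → ℝ} (hp : Measurable p)
    {z : α → Real.Angle × Fin 2} (hz : Measurable z) :
    Measurable fun x => transition a b β u (p x) f (z x) := by
  have h := (measurable_transition (β := β) (u := u) hb a hf).comp (hp.prodMk hz)
  exact h

omit hβ hu in
theorem measurable_jump_transition {α : Type*} [MeasurableSpace α]
    {f : Real.Angle × Fin 2 → ENNReal} (hf : Measurable f) {p : α → ℝ} (hp : Measurable p)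
    {z : α → Real.Angle × Fin 2} (hz : Measurable z) :
    Measurable fun x => jump β u (transition a b β u (p x) f) (z x) :=
  measurable_jump (f := fun x => transition a b β u (p x) f)
    (measurable_transition_comp hb a hf (hp.comp measurable_fst) measurable_snd) hz

omit hβ hu in
theorem measurable_noJump_jump_transition {α : Type*} [MeasurableSpace α]
    {f : Real.Angle × Fin 2 → ENNReal} (hf : Measurable f) {p q : α → ℝ} (hp : Measurable p)
    (hq : Measurable q) {z : α → Real.Angle × Fin 2} (hz : Measurable z) :
    Measurable fun x => noJump a b β u (q x) (jump β u (transition a b β u (p x) f)) (z x) :=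
  measurable_noJump (f := fun x => jump β u (transition a b β u (p x) f)) hb a
    (measurable_jump_transition hb a hf (hp.comp measurable_fst) measurable_snd) hq hz

omit hβ hu in
theorem measurable_jump_noJump_jump_transition {α : Type*} [MeasurableSpace α]
    {f : Real.Angle × Fin 2 → ENNReal} (hf : Measurable f) {p q : α → ℝ} (hp : Measurable p)
    (hq : Measurable q) {z : α → Real.Angle × Fin 2} (hz : Measurable z) :
    Measurable fun x => jump β u
      (noJump a b β u (q x) (jump β u (transition a b β u (p x) f))) (z x) :=
  measurable_jump (f := fun x => noJump a b β u (q x) (jump β u (transition a b β u (p x) f)))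
    (measurable_noJump_jump_transition hb a hf (hp.comp measurable_fst) (hq.comp measurable_fst)
      measurable_snd) hz

omit hb hβ hu in
/-- Two parametrisations of the triangle `0 < q`, `0 ≤ p`, `q + p ≤ t`. -/
theorem lintegral_triangle {Y : ℝ → ℝ → ENNReal} (hY : Measurable fun q : ℝ × ℝ => Y q.1 q.2)
    (t : ℝ) : ∫⁻ s in Set.Ioc 0 t, ∫⁻ q in Set.Ioc 0 s, Y q (s - q) =
      ∫⁻ r in Set.Ioc 0 t, ∫⁻ q in Set.Ioc 0 r, Y q (t - r) := by
  set W : ℝ → ℝ → ENNReal := fun q p => if 0 < q ∧ 0 ≤ p ∧ q + p ≤ t then Y q p else 0 with hW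
  have hWm : Measurable fun q : ℝ × ℝ => W q.1 q.2 := by
    refine Measurable.ite ?_ hY measurable_const
    exact (measurableSet_lt measurable_const measurable_fst).inter
      ((measurableSet_le measurable_const measurable_snd).inter
        (measurableSet_le (measurable_fst.add measurable_snd) measurable_const))
  have hX1 : ∫⁻ s in Set.Ioc 0 t, ∫⁻ q in Set.Ioc 0 s, Y q (s - q) = ∫⁻ s, ∫⁻ q, W q (s - q) := by
    rw [← lintegral_indicator measurableSet_Ioc]
    refine lintegral_congr fun s => ?_
    by_cases hs : s ∈ Set.Ioc 0 t
    · rw [Set.indicator_of_mem hs, ← lintegral_indicator measurableSet_Ioc]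
      refine lintegral_congr fun q => ?_
      simp only [Set.indicator, hW, Set.mem_Ioc]
      have := hs.2
      exact if_congr ⟨fun h => ⟨h.1, by linarith [h.2], by linarith⟩,
        fun h => ⟨h.1, by linarith [h.2.1]⟩⟩ rfl rfl
    · rw [Set.indicator_of_notMem hs, lintegral_eq_zero_of_ae_eq_zero]
      exact Filter.Eventually.of_forall fun q => if_neg fun h =>
        hs ⟨by linarith [h.1, h.2.1], by linarith [h.2.2]⟩
  have hX2 : ∫⁻ r in Set.Ioc 0 t, ∫⁻ q in Set.Ioc 0 r, Y q (t - r) = ∫⁻ r, ∫⁻ q, W q (t - r) := by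
    rw [← lintegral_indicator measurableSet_Ioc]
    refine lintegral_congr fun r => ?_
    by_cases hs : r ∈ Set.Ioc 0 t
    · rw [Set.indicator_of_mem hs, ← lintegral_indicator measurableSet_Ioc]
      refine lintegral_congr fun q => ?_
      simp only [Set.indicator, hW, Set.mem_Ioc]
      have := hs.2
      exact if_congr ⟨fun h => ⟨h.1, by linarith, by linarith [h.2]⟩,
        fun h => ⟨h.1, by linarith [h.2.2]⟩⟩ rfl rfl
    · rw [Set.indicator_of_notMem hs, lintegral_eq_zero_of_ae_eq_zero]
      exact Filter.Eventually.of_forall fun q => if_neg fun h =>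
        hs ⟨by linarith [h.1, h.2.2], by linarith [h.2.1]⟩
  have hm1 : Measurable fun p : ℝ × ℝ => W p.2 (p.1 - p.2) := by
    have h := hWm.comp (measurable_snd.prodMk (measurable_fst.sub measurable_snd))
    exact h
  have hm2 : Measurable fun p : ℝ × ℝ => W p.2 p.1 := by
    have h := hWm.comp measurable_swap
    exact h
  calc ∫⁻ s in Set.Ioc 0 t, ∫⁻ q in Set.Ioc 0 s, Y q (s - q)
      = ∫⁻ q, ∫⁻ s, W q (s - q) := hX1.trans (lintegral_lintegral_swap hm1.aemeasurable)
    _ = ∫⁻ q, ∫⁻ p, W q p := lintegral_congr fun q => lintegral_sub_right_eq_self (W q) q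
    _ = ∫⁻ p, ∫⁻ q, W q p := (lintegral_lintegral_swap hm2.aemeasurable).symm
    _ = ∫⁻ r, ∫⁻ q, W q (t - r) :=
      (lintegral_sub_left_eq_self (fun p => ∫⁻ q, W q p) t).symm
    _ = _ := hX2.symm

omit hb hβ hu in
theorem lintegral_Ioc_sub_left (F : ℝ → ENNReal) (t : ℝ) :
    ∫⁻ r in Set.Ioc 0 t, F (t - r) = ∫⁻ s in Set.Ioc 0 t, F s := by
  have h := (Measure.measurePreserving_sub_left volume t).setLIntegral_comp_preimage_emb
    (measurableEmbedding_subLeft t) F (Set.Icc 0 t)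
  rw [Set.preimage_const_sub_Icc, sub_self, sub_zero] at h
  rw [setLIntegral_congr (Ioc_ae_eq_Icc (a := (0 : ℝ)) (b := t)), h,
    setLIntegral_congr (Ioc_ae_eq_Icc (a := (0 : ℝ)) (b := t))]

/-- The explicit measure is preserved by the transition operators. The renewal equation and the
Duhamel form of stationarity expand both sides into the same terms, up to the mass `Y q p` of the
paths with two consecutive jumps separated by the time `q`, which is finite and cancels. -/
theorem lintegral_transition {f : Real.Angle × Fin 2 → ENNReal} (hf : Measurable f)
    (hf1 : ∀ z, f z ≤ 1) {t : ℝ} (ht : 0 ≤ t) :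
    ∫⁻ z, transition a b β u t f z ∂densityMeasure (rho a b β u) =
      ∫⁻ z, f z ∂densityMeasure (rho a b β u) := by
  have hprob := isProbabilityMeasure_density hb a hβ hu
  set μ := densityMeasure (rho a b β u) with hμ
  set Y : ℝ → ℝ → ENNReal := fun q p =>
    ∫⁻ z, jump β u (noJump a b β u q (jump β u (transition a b β u p f))) z ∂μ with hY
  have hYm : Measurable fun q : ℝ × ℝ => Y q.1 q.2 := by
    have h : Measurable fun x : (ℝ × ℝ) × (Real.Angle × Fin 2) => jump β u
        (noJump a b β u x.1.1 (jump β u (transition a b β u x.1.2 f))) x.2 :=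
      measurable_jump_noJump_jump_transition hb a hf (by fun_prop) (by fun_prop) measurable_snd
    exact h.lintegral_prod_right'
  have hJPr : ∀ r, Measurable (jump β u (transition a b β u r f)) := fun r =>
    measurable_jump_transition hb a hf measurable_const measurable_id
  have hnJ : ∀ q, Measurable (noJump a b β u q f) := fun q =>
    measurable_noJump (f := fun _ : Real.Angle × Fin 2 => f) hb a (hf.comp measurable_snd)
      measurable_const measurable_id
  have hXfin : ∫⁻ r in Set.Ioc 0 t, ∫⁻ q in Set.Ioc 0 r, Y q (t - r) ≠ ⊤ := by
    have hPle : ∀ p z, transition a b β u p f z ≤ 1 := fun p z =>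
      (lintegral_mono fun ω => hf1 _).trans (by simp)
    have hYle : ∀ q p, 0 ≤ q → Y q p ≤ ENNReal.ofReal β * (ENNReal.ofReal β * 1) := fun q p hq =>
      (lintegral_mono fun z => jump_le hβ hu
        (noJump_le a hβ hu (jump_le hβ hu (hPle p)) hq) z).trans (by simp)
    have h1 : ∫⁻ r in Set.Ioc 0 t, ∫⁻ q in Set.Ioc 0 r, Y q (t - r) ≤
        ∫⁻ r in Set.Ioc 0 t, ∫⁻ q in Set.Ioc 0 t, ENNReal.ofReal β * (ENNReal.ofReal β * 1) := by
      refine setLIntegral_mono measurable_const fun r hr => ?_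
      refine (setLIntegral_mono measurable_const fun q hq => hYle q _ hq.1.le).trans ?_
      exact lintegral_mono_set (Set.Ioc_subset_Ioc_right hr.2)
    refine ne_top_of_le_ne_top ?_ h1
    simp [ENNReal.mul_eq_top]
  have hA : ∫⁻ z, transition a b β u t f z ∂μ + ∫⁻ r in Set.Ioc 0 t, ∫⁻ q in Set.Ioc 0 r,
      Y q (t - r) = ∫⁻ z, noJump a b β u t f z ∂μ +
        ∫⁻ r in Set.Ioc 0 t, ∫⁻ z, jump β u (transition a b β u (t - r) f) z ∂μ := by
    have hm : Measurable fun p : (Real.Angle × Fin 2) × ℝ =>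
        noJump a b β u p.2 (jump β u (transition a b β u (t - p.2) f)) p.1 :=
      measurable_noJump_jump_transition hb a hf (by fun_prop) (by fun_prop) measurable_fst
    have hm' : Measurable fun p : ℝ × (Real.Angle × Fin 2) =>
        noJump a b β u p.1 (jump β u (transition a b β u (t - p.1) f)) p.2 :=
      measurable_noJump_jump_transition hb a hf (by fun_prop) (by fun_prop) measurable_snd
    simp only [transition_eq hb a hβ hu hf ht]
    rw [lintegral_add_left (hnJ t), add_assoc]
    congr 1
    rw [lintegral_lintegral_swap hm.aemeasurable, ← lintegral_add_left hm'.lintegral_prod_right']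
    refine setLIntegral_congr_fun measurableSet_Ioc fun r hr => ?_
    exact (lintegral_duhamel hb a hβ hu (hJPr (t - r)) hr.1.le).symm
  have hC : ∫⁻ s in Set.Ioc 0 t, ∫⁻ z, jump β u (transition a b β u s f) z ∂μ =
      (∫⁻ s in Set.Ioc 0 t, ∫⁻ z, jump β u (noJump a b β u s f) z ∂μ) +
      ∫⁻ s in Set.Ioc 0 t, ∫⁻ q in Set.Ioc 0 s, Y q (s - q) := by
    have hm : Measurable fun p : ℝ × (Real.Angle × Fin 2) =>
        jump β u (noJump a b β u p.1 f) p.2 :=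
      measurable_jump (f := fun p : ℝ × (Real.Angle × Fin 2) => noJump a b β u p.1 f)
        (measurable_noJump (f := fun _ => f) hb a (hf.comp measurable_snd) (by fun_prop)
          measurable_snd) measurable_snd
    rw [← lintegral_add_left hm.lintegral_prod_right']
    refine setLIntegral_congr_fun measurableSet_Ioc fun s hs => ?_
    have hm2 : Measurable fun p : ℝ × (Real.Angle × Fin 2) => jump β u
        (noJump a b β u p.1 (jump β u (transition a b β u (s - p.1) f))) p.2 :=
      measurable_jump_noJump_jump_transition hb a hf (by fun_prop) (by fun_prop) measurable_snd
    have hms : Measurable fun z => jump β u (noJump a b β u s f) z := by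
      have h := hm.comp (measurable_const (a := s).prodMk measurable_id)
      exact h
    simp only [hY]
    rw [lintegral_lintegral_swap hm2.aemeasurable, ← lintegral_add_left hms]
    refine lintegral_congr fun z => ?_
    have hm3 : Measurable fun q => noJump a b β u q (jump β u (transition a b β u (s - q) f))
        (z.1, 1 - z.2) :=
      measurable_noJump_jump_transition hb a hf (by fun_prop) (by fun_prop) measurable_const
    simp only [jump.eq_def (f := transition a b β u s f), transition_eq hb a hβ hu hf hs.1.le]
    rw [mul_add, ← lintegral_const_mul _ hm3]
    rfl
  rw [lintegral_Ioc_sub_left (fun s => ∫⁻ z, jump β u (transition a b β u s f) z ∂μ), hC,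
    ← add_assoc, ← lintegral_duhamel hb a hβ hu hf ht, lintegral_triangle hYm] at hA
  exact (ENNReal.add_left_inj hXfin).1 hA

theorem isInvariant_density : IsInvariant a b β u (densityMeasure (rho a b β u)) := by
  intro t ht
  have hprob := isProbabilityMeasure_density hb a hβ hu
  have hm : Measurable (angularProcess a b β u t) :=
    measurable_angularProcess_comp hb a β u measurable_const measurable_fst measurable_snd
  refine ⟨hm, Measure.ext fun B hB => ?_⟩
  have hind : Measurable (B.indicator (1 : Real.Angle × Fin 2 → ENNReal)) :=
    measurable_one.indicator hB
  have h := lintegral_transition hb a hβ hu hind (fun z => Set.indicator_le_self _ _ z) ht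
  rw [lintegral_indicator_one hB] at h
  rw [← h, ← lintegral_indicator_one hB, lintegral_map hind hm, lintegral_prod]
  · rfl
  · exact (hind.comp hm).aemeasurable

end Invariance

/-! ### Stationary measures annihilate the generator -/

theorem continuous_of_comp_coe {F : Real.Angle → ℝ} (hF : Continuous fun x : ℝ => F x) :
    Continuous F :=
  (QuotientAddGroup.isQuotientMap_mk (N := AddSubgroup.zmultiples (2 * Real.pi))).continuous_iff.2
    hF

theorem exists_bound {F : Real.Angle → ℝ} (hF : Continuous F) : ∃ M, ∀ θ, |F θ| ≤ M := by
  obtain ⟨M, hM⟩ := isCompact_Icc.exists_bound_of_continuousOn (s := Set.Icc (-Real.pi) Real.pi)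
    (hF.comp Real.Angle.continuous_coe).continuousOn
  refine ⟨M, fun θ => ?_⟩
  have := hM θ.toReal ⟨(Real.Angle.neg_pi_lt_toReal θ).le, Real.Angle.toReal_le_pi θ⟩
  simpa using this

theorem exists_lift {g : ℝ → ℝ} (hg : Function.Periodic g (2 * Real.pi)) :
    ∃ G : Real.Angle → ℝ, ∀ x : ℝ, G x = g x :=
  ⟨hg.lift, fun _ => rfl⟩

/-- The angular speed `d_i`, as a function on the circle. -/
noncomputable def angularSpeed (b : ℝ) (i : Fin 2) (θ : Real.Angle) : ℝ :=
  -(axis b i * θ.sin ^ 2 + 1 / axis b i * θ.cos ^ 2)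

theorem angularSpeed_coe (a b : ℝ) (i : Fin 2) (x : ℝ) :
    angularSpeed b i (x : Real.Angle) = d a b i x := by
  rw [d_eq, angularSpeed, Real.Angle.sin_coe, Real.Angle.cos_coe]

theorem continuous_angularSpeed (b : ℝ) (i : Fin 2) : Continuous (angularSpeed b i) := by
  have h1 := Real.Angle.continuous_sin
  have h2 := Real.Angle.continuous_cos
  unfold angularSpeed
  fun_prop

theorem angularSpeed_neg {b : ℝ} (hb : 0 < b) (i : Fin 2) (θ : Real.Angle) :
    angularSpeed b i θ < 0 := by
  induction θ using Real.Angle.induction_on with | _ x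
  rw [angularSpeed_coe 0]
  exact d_neg hb 0 i x

section Generator

variable {b β u : ℝ} (hb : 0 < b) (a : ℝ) (hβ : 0 < β) (hu : u ∈ Set.Ioo (0 : ℝ) 1)
include hb

theorem flow_zero (i : Fin 2) (θ : Real.Angle) : flow a b i 0 θ = θ := by
  induction θ using Real.Angle.induction_on with | _ x
  obtain ⟨s, rfl⟩ := surjective_ellipseAngle (axis_pos hb i) x
  rw [flow_ellipseAngle hb, sub_zero]

theorem hasDerivAt_comp_flow {F F' : Real.Angle → ℝ}
    (hF : ∀ x : ℝ, HasDerivAt (fun y : ℝ => F y) (F' x) x) (i : Fin 2) (θ : Real.Angle) (t : ℝ) :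
    HasDerivAt (fun t => F (flow a b i t θ))
      (angularSpeed b i (flow a b i t θ) * F' (flow a b i t θ)) t := by
  induction θ using Real.Angle.induction_on with | _ x
  obtain ⟨s, rfl⟩ := surjective_ellipseAngle (axis_pos hb i) x
  simp only [flow_ellipseAngle hb]
  have h1 := (hasDerivAt_ellipseAngle (axis_pos hb i) (s - t)).comp_const_sub s t
  have h2 := (hF (ellipseAngle (axis b i) (s - t))).comp t h1
  refine h2.congr_deriv ?_
  rw [angularSpeed_coe a, ellipseSpeed_eq_neg_d hb a]
  ring

theorem exists_lipschitz_flow {F F' : Real.Angle → ℝ} (hF' : Continuous F')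
    (hF : ∀ x : ℝ, HasDerivAt (fun y : ℝ => F y) (F' x) x) (i : Fin 2) :
    ∃ D, 0 ≤ D ∧ ∀ θ t, 0 ≤ t → |F (flow a b i t θ) - F θ| ≤ D * t := by
  obtain ⟨M, hM⟩ := exists_bound ((continuous_angularSpeed b i).mul hF')
  refine ⟨M, (abs_nonneg _).trans (hM 0), fun θ t ht => ?_⟩
  have h := Convex.norm_image_sub_le_of_norm_hasDerivWithin_le (s := Set.univ) (x := 0) (y := t)
    (fun x _ => (hasDerivAt_comp_flow hb a hF i θ x).hasDerivWithinAt) (fun x _ => hM _)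
    convex_univ trivial trivial
  rwa [flow_zero hb, sub_zero, Real.norm_of_nonneg ht, Real.norm_eq_abs] at h

include hβ hu

/-- Short-time expansion of the transition operators, with a uniform remainder. -/
theorem exists_expansion {f : Real.Angle × Fin 2 → ℝ} (hf : Measurable f) {M D : ℝ}
    (hM : ∀ z, |f z| ≤ M) (hD0 : 0 ≤ D)
    (hD : ∀ i j θ t, 0 ≤ t → |f (flow a b j t θ, i) - f (θ, i)| ≤ D * t) :
    ∃ E, ∀ t θ i, 0 ≤ t →
      |∫ ω, f (angularProcess a b β u t ((θ, i), ω)) ∂clockLaw - f (θ, i)| ≤ E * t ∧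
      |∫ ω, f (angularProcess a b β u t ((θ, i), ω)) ∂clockLaw -
        (Real.exp (-(rate β u i * t)) * f (flow a b i t θ, i) +
          (1 - Real.exp (-(rate β u i * t))) * f (θ, 1 - i))| ≤ (E + D) * β * t ^ 2 := by
  have hM0 : 0 ≤ M := (abs_nonneg _).trans (hM (0, 0))
  have hexp : ∀ (i : Fin 2) (t : ℝ), 0 ≤ t → 0 ≤ 1 - Real.exp (-(rate β u i * t)) ∧
      1 - Real.exp (-(rate β u i * t)) ≤ β * t := by
    intro i t ht
    have h1 := rate_pos hβ hu i
    have h2 := mul_le_mul_of_nonneg_right (rate_le hβ hu i) ht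
    have h3 := Real.add_one_le_exp (-(rate β u i * t))
    have h4 : Real.exp (-(rate β u i * t)) ≤ 1 := by
      rw [Real.exp_le_one_iff]
      have := mul_nonneg h1.le ht
      linarith
    exact ⟨by linarith, by linarith⟩
  have hmass : ∀ (i : Fin 2) (t : ℝ), 0 ≤ t → (expMeasure (rate β u i)).real (Set.Iic t) =
      1 - Real.exp (-(rate β u i * t)) := by
    intro i t ht
    rw [measureReal_def, expMeasure_Iic (rate_pos hβ hu i) ht, ENNReal.toReal_ofReal
      (hexp i t ht).1]
  have hP : ∀ t z, |∫ ω, f (angularProcess a b β u t (z, ω)) ∂clockLaw| ≤ M := by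
    intro t z
    have := norm_integral_le_of_norm_le_const (μ := clockLaw)
      (f := fun ω => f (angularProcess a b β u t (z, ω)))
      (Filter.Eventually.of_forall fun ω => hM _)
    simpa using this
  have hfirst : ∀ t θ i, 0 ≤ t →
      |∫ ω, f (angularProcess a b β u t ((θ, i), ω)) ∂clockLaw - f (θ, i)| ≤
        (D + 2 * M * β) * t := by
    intro t θ i ht
    have := isProbabilityMeasure_expMeasure (rate_pos hβ hu i)
    have h1 : |∫ s in Set.Iic t, (∫ ω, f (angularProcess a b β u (t - s)
        ((flow a b i s θ, 1 - i), ω)) ∂clockLaw) ∂expMeasure (rate β u i)| ≤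
        M * (1 - Real.exp (-(rate β u i * t))) := by
      rw [← hmass i t ht]
      exact norm_setIntegral_le_of_norm_le_const (f := fun s => ∫ ω, f (angularProcess a b β u
        (t - s) ((flow a b i s θ, 1 - i), ω)) ∂clockLaw) (measure_lt_top _ _) fun s _ => hP _ _
    rw [integral_angularProcess hb a hβ hu hf hM ht]
    obtain ⟨e1, e2⟩ := hexp i t ht
    have e3 := (Real.exp_pos (-(rate β u i * t))).le
    have h2 := hD i i θ t ht
    have h3 := hM (θ, i)
    rw [abs_le] at h1 h2 h3 ⊢
    have hDt := mul_nonneg hD0 ht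
    constructor <;> nlinarith
  refine ⟨D + 2 * M * β, fun t θ i ht => ⟨hfirst t θ i ht, ?_⟩⟩
  have := isProbabilityMeasure_expMeasure (rate_pos hβ hu i)
  have hint : Integrable (fun s => ∫ ω, f (angularProcess a b β u (t - s)
      ((flow a b i s θ, 1 - i), ω)) ∂clockLaw) (expMeasure (rate β u i)) := by
    have hm : Measurable fun p : ℝ × (ℕ → ℝ) => f (angularProcess a b β u (t - p.1)
        ((flow a b i p.1 θ, 1 - i), p.2)) :=
      hf.comp (measurable_angularProcess_comp hb a β u (by fun_prop)
        ((Measurable.angularFlow hb a measurable_fst measurable_const measurable_const).prodMk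
          measurable_const) measurable_snd)
    exact Integrable.of_bound hm.stronglyMeasurable.integral_prod_right'.aestronglyMeasurable M
      (Filter.Eventually.of_forall fun s => hP _ _)
  have hconst : ∫ s in Set.Iic t, f (θ, 1 - i) ∂expMeasure (rate β u i) =
      (1 - Real.exp (-(rate β u i * t))) * f (θ, 1 - i) := by
    rw [setIntegral_const, hmass i t ht, smul_eq_mul]
  rw [integral_angularProcess hb a hβ hu hf hM ht, add_sub_add_left_eq_sub, ← hconst,
    ← integral_sub hint.integrableOn (integrable_const _)]
  obtain ⟨e1, e2⟩ := hexp i t ht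
  have hE : 0 ≤ D + 2 * M * β := by positivity
  have hbound : ∀ᵐ s ∂expMeasure (rate β u i), s ∈ Set.Iic t →
      ‖(∫ ω, f (angularProcess a b β u (t - s) ((flow a b i s θ, 1 - i), ω)) ∂clockLaw) -
        f (θ, 1 - i)‖ ≤ (D + 2 * M * β + D) * t := by
    filter_upwards [ae_expMeasure_pos (rate_pos hβ hu i)] with s hs hst
    have hst' : s ≤ t := hst
    have h1 := hfirst (t - s) (flow a b i s θ) (1 - i) (by linarith)
    have h2 := hD (1 - i) i θ s hs.le
    have h3 : (D + 2 * M * β) * (t - s) ≤ (D + 2 * M * β) * t :=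
      mul_le_mul_of_nonneg_left (by linarith) hE
    have h4 : D * s ≤ D * t := mul_le_mul_of_nonneg_left hst' hD0
    rw [Real.norm_eq_abs]
    rw [abs_le] at h1 h2 ⊢
    constructor <;> linarith
  have h5 := norm_setIntegral_le_of_norm_le_const_ae (measure_lt_top _ _)
    ((ae_restrict_iff' measurableSet_Iic).2 hbound)
  rw [Real.norm_eq_abs, hmass i t ht] at h5
  refine h5.trans ?_
  calc (D + 2 * M * β + D) * t * (1 - Real.exp (-(rate β u i * t)))
      ≤ (D + 2 * M * β + D) * t * (β * t) :=
        mul_le_mul_of_nonneg_left e2 (by positivity)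
    _ = (D + 2 * M * β + D) * β * t ^ 2 := by ring

/-- An invariant probability measure annihilates the generator, on continuously differentiable
functions. -/
theorem integral_generator {ν : Measure (Real.Angle × Fin 2)} [IsProbabilityMeasure ν]
    (hν : IsInvariant a b β u ν) {F F' : Fin 2 → Real.Angle → ℝ} (hF' : ∀ i, Continuous (F' i))
    (hF : ∀ i (x : ℝ), HasDerivAt (fun y : ℝ => F i y) (F' i x) x) :
    ∫ z, (angularSpeed b z.2 z.1 * F' z.2 z.1 +
      rate β u z.2 * (F (1 - z.2) z.1 - F z.2 z.1)) ∂ν = 0 := by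
  have hFc : ∀ i, Continuous (F i) := fun i => continuous_of_comp_coe
    (continuous_iff_continuousAt.2 fun x => (hF i x).continuousAt)
  set f : Real.Angle × Fin 2 → ℝ := fun z => F z.2 z.1 with hfdef
  have hf : Measurable f := measurable_of_countable_index measurable_snd
    (g := fun i (z : Real.Angle × Fin 2) => F i z.1) fun i => (hFc i).measurable.comp measurable_fst
  obtain ⟨M0, hM0⟩ := exists_bound (hFc 0)
  obtain ⟨M1, hM1⟩ := exists_bound (hFc 1)
  have hM : ∀ z, |f z| ≤ max M0 M1 := by
    rintro ⟨θ, i⟩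
    fin_cases i
    · exact (hM0 θ).trans (le_max_left _ _)
    · exact (hM1 θ).trans (le_max_right _ _)
  choose D hD0 hD using fun i j => exists_lipschitz_flow hb a (hF' i) (hF i) j
  obtain ⟨E, hE⟩ := exists_expansion hb a hβ hu (D := ∑ i, ∑ j, D i j) hf hM
    (Finset.sum_nonneg fun i _ => Finset.sum_nonneg fun j _ => hD0 i j) (by
      intro i j θ t ht
      refine (hD i j θ t ht).trans (mul_le_mul_of_nonneg_right ?_ ht)
      exact (Finset.single_le_sum (f := fun j => D i j) (fun j _ => hD0 i j)
        (Finset.mem_univ j)).trans (Finset.single_le_sum (f := fun i => ∑ j, D i j)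
          (fun i _ => Finset.sum_nonneg fun j _ => hD0 i j) (Finset.mem_univ i)))
  set D' := ∑ i, ∑ j, D i j
  set P : ℝ → Real.Angle × Fin 2 → ℝ := fun t z =>
    ∫ ω, f (angularProcess a b β u t (z, ω)) ∂clockLaw with hPdef
  have hPm : ∀ t, StronglyMeasurable (P t) := by
    intro t
    have hm : Measurable fun p : (Real.Angle × Fin 2) × (ℕ → ℝ) =>
        f (angularProcess a b β u t (p.1, p.2)) :=
      hf.comp
        (measurable_angularProcess_comp hb a β u measurable_const measurable_fst measurable_snd)
    exact hm.stronglyMeasurable.integral_prod_right'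
  have hfi : Integrable f ν :=
    Integrable.of_bound hf.aestronglyMeasurable _ (Filter.Eventually.of_forall hM)
  have hPi : ∀ t, 0 ≤ t → Integrable (P t) ν ∧ ∫ z, P t z ∂ν = ∫ z, f z ∂ν := by
    intro t ht
    have hmp := hν t ht
    have hi : Integrable (f ∘ angularProcess a b β u t) (ν.prod clockLaw) :=
      hmp.integrable_comp_of_integrable hfi
    refine ⟨hi.integral_prod_left, ?_⟩
    have h := integral_map (μ := ν.prod clockLaw) hmp.measurable.aemeasurable
      hf.aestronglyMeasurable
    rw [hmp.map_eq] at h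
    rw [h]
    exact (integral_prod _ hi).symm
  have hlim : ∀ z : Real.Angle × Fin 2, Filter.Tendsto (fun t => t⁻¹ * (P t z - f z))
      (nhdsWithin 0 (Set.Ioi 0)) (nhds (angularSpeed b z.2 z.1 * F' z.2 z.1 +
        rate β u z.2 * (F (1 - z.2) z.1 - F z.2 z.1))) := by
    rintro ⟨θ, i⟩
    have hexp : HasDerivAt (fun t => Real.exp (-(rate β u i * t))) (-rate β u i) 0 := by
      have := ((hasDerivAt_id (0 : ℝ)).const_mul (rate β u i)).neg.exp
      simpa using this
    have hG := (hexp.mul (hasDerivAt_comp_flow hb a (hF i) i θ 0)).add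
      ((hexp.const_sub 1).mul_const (F (1 - i) θ))
    have hG' := (hasDerivAt_iff_tendsto_slope.1 hG).mono_left
      (nhdsWithin_mono 0 (fun x (hx : 0 < x) => hx.ne'))
    have hrem : Filter.Tendsto (fun t => t⁻¹ * (P t (θ, i) -
        (Real.exp (-(rate β u i * t)) * f (flow a b i t θ, i) +
          (1 - Real.exp (-(rate β u i * t))) * f (θ, 1 - i))))
        (nhdsWithin 0 (Set.Ioi 0)) (nhds 0) := by
      have h0 : Filter.Tendsto (fun t : ℝ => (E + D') * β * t) (nhdsWithin 0 (Set.Ioi 0))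
          (nhds 0) := by
        have : Continuous fun t : ℝ => (E + D') * β * t := by fun_prop
        simpa using (this.tendsto 0).mono_left nhdsWithin_le_nhds
      refine squeeze_zero_norm' ?_ h0
      filter_upwards [self_mem_nhdsWithin] with t ht
      have ht' : 0 < t := ht
      have h1 := (hE t θ i ht'.le).2
      rw [norm_mul, norm_inv, Real.norm_of_nonneg ht'.le, Real.norm_eq_abs,
        inv_mul_le_iff₀ ht']
      calc _ ≤ _ := h1
        _ = _ := by ring
    have hsum := hrem.add hG'
    rw [zero_add] at hsum
    refine (hsum.congr fun t => ?_).trans (le_of_eq ?_)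
    · simp only [slope, vsub_eq_sub, sub_zero, smul_eq_mul, Pi.add_apply, Pi.mul_apply, mul_zero,
        neg_zero, Real.exp_zero, flow_zero hb, hfdef]
      ring
    · simp only [flow_zero hb, mul_zero, neg_zero, Real.exp_zero]
      congr 1
      ring
  have hconv := tendsto_integral_filter_of_dominated_convergence (μ := ν)
    (l := nhdsWithin (0 : ℝ) (Set.Ioi 0)) (F := fun t z => t⁻¹ * (P t z - f z)) (fun _ => E)
    (Filter.Eventually.of_forall fun t =>
      (((hPm t).aestronglyMeasurable.sub hf.aestronglyMeasurable).const_mul _)) (by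
      filter_upwards [self_mem_nhdsWithin] with t ht
      refine Filter.Eventually.of_forall fun z => ?_
      have ht' : 0 < t := ht
      have h1 := (hE t z.1 z.2 ht'.le).1
      rw [norm_mul, norm_inv, Real.norm_of_nonneg ht'.le, Real.norm_eq_abs,
        inv_mul_le_iff₀ ht', mul_comm t]
      exact h1) (integrable_const E) (Filter.Eventually.of_forall hlim)
  refine tendsto_nhds_unique hconv (tendsto_const_nhds.congr' ?_)
  filter_upwards [self_mem_nhdsWithin] with t ht
  have ht' : 0 < t := ht
  obtain ⟨h1, h2⟩ := hPi t ht'.le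
  rw [integral_const_mul, integral_sub h1 hfi, h2, sub_self, mul_zero]

end Generator

/-! ### Uniqueness of the invariant measure -/

/-- The restriction to mode `i` of a measure on the circle times the modes. -/
noncomputable def modeMarginal (ν : Measure (Real.Angle × Fin 2)) (i : Fin 2) :
    Measure Real.Angle :=
  (ν.restrict (Prod.snd ⁻¹' {i})).map Prod.fst

instance (ν : Measure (Real.Angle × Fin 2)) [IsFiniteMeasure ν] (i : Fin 2) :
    IsFiniteMeasure (modeMarginal ν i) := by
  unfold modeMarginal
  infer_instance

theorem modeMarginal_apply (ν : Measure (Real.Angle × Fin 2)) (i : Fin 2) {s : Set Real.Angle}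
    (hs : MeasurableSet s) : modeMarginal ν i s = ν (s ×ˢ {i}) := by
  rw [modeMarginal, Measure.map_apply measurable_fst hs,
    Measure.restrict_apply (measurable_fst hs), Set.prod_eq]

theorem ext_modeMarginal {ν ν' : Measure (Real.Angle × Fin 2)} [IsFiniteMeasure ν]
    (h : ∀ i, modeMarginal ν i = modeMarginal ν' i) : ν = ν' := by
  refine Measure.ext fun s hs => ?_
  have hsplit : s = ⋃ i : Fin 2, ((fun θ => (θ, i)) ⁻¹' s) ×ˢ {i} := by
    ext ⟨θ, i⟩
    simp
  have hm : ∀ i : Fin 2, MeasurableSet ((fun θ : Real.Angle => (θ, i)) ⁻¹' s) := fun i =>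
    (measurable_id.prodMk measurable_const) hs
  have hd : Pairwise (Function.onFun Disjoint
      fun i : Fin 2 => ((fun θ : Real.Angle => (θ, i)) ⁻¹' s) ×ˢ ({i} : Set (Fin 2))) := by
    intro i j hij
    rw [Function.onFun, Set.disjoint_left]
    rintro ⟨θ, k⟩ h1 h2
    exact hij (h1.2.symm.trans h2.2)
  have hms := fun i => (hm i).prod (measurableSet_singleton i)
  rw [hsplit, measure_iUnion hd hms, measure_iUnion hd hms]
  refine tsum_congr fun i => ?_
  rw [← modeMarginal_apply ν i (hm i), h i, modeMarginal_apply ν' i (hm i)]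

theorem integral_eq_modeMarginal (ν : Measure (Real.Angle × Fin 2)) [IsFiniteMeasure ν]
    {H : Fin 2 → Real.Angle → ℝ} (hH : ∀ i, Continuous (H i)) :
    ∫ z, H z.2 z.1 ∂ν = ∫ θ, H 0 θ ∂modeMarginal ν 0 + ∫ θ, H 1 θ ∂modeMarginal ν 1 := by
  have hms : ∀ i : Fin 2, MeasurableSet (Prod.snd ⁻¹' {i} : Set (Real.Angle × Fin 2)) := fun i =>
    measurable_snd (measurableSet_singleton i)
  have hmap : ∀ i, ∫ θ, H i θ ∂modeMarginal ν i = ∫ z in Prod.snd ⁻¹' {i}, H z.2 z.1 ∂ν := by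
    intro i
    rw [modeMarginal, integral_map measurable_fst.aemeasurable
      (hH i).measurable.aestronglyMeasurable]
    refine setIntegral_congr_fun (hms i) fun z hz => ?_
    have : z.2 = i := hz
    simp only [this]
  have hcompl : (Prod.snd ⁻¹' {0} : Set (Real.Angle × Fin 2))ᶜ = Prod.snd ⁻¹' {1} := by
    ext ⟨θ, i⟩
    fin_cases i <;> simp
  obtain ⟨M0, hM0⟩ := exists_bound (hH 0)
  obtain ⟨M1, hM1⟩ := exists_bound (hH 1)
  have hm : Measurable fun z : Real.Angle × Fin 2 => H z.2 z.1 :=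
    measurable_of_countable_index measurable_snd (g := fun i (z : Real.Angle × Fin 2) => H i z.1)
      fun i => (hH i).measurable.comp measurable_fst
  have hint : Integrable (fun z : Real.Angle × Fin 2 => H z.2 z.1) ν := by
    refine Integrable.of_bound hm.aestronglyMeasurable (max M0 M1)
      (Filter.Eventually.of_forall ?_)
    rintro ⟨θ, i⟩
    fin_cases i
    · exact (hM0 θ).trans (le_max_left _ _)
    · exact (hM1 θ).trans (le_max_right _ _)
  rw [hmap, hmap, ← hcompl, integral_add_compl (hms 0) hint]

theorem integrable_of_continuous {μ : Measure Real.Angle} [IsFiniteMeasure μ]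
    {F : Real.Angle → ℝ} (hF : Continuous F) : Integrable F μ := by
  obtain ⟨M, hM⟩ := exists_bound hF
  exact Integrable.of_bound hF.measurable.aestronglyMeasurable M (Filter.Eventually.of_forall hM)

theorem periodic_coe (F : Real.Angle → ℝ) :
    Function.Periodic (fun x : ℝ => F x) (2 * Real.pi) := by
  intro x
  simp

/-- A periodic function with zero mean has a periodic primitive. -/
theorem exists_primitive {k : Real.Angle → ℝ} (hk : Continuous k)
    (h0 : ∫ x in (0 : ℝ)..(2 * Real.pi), k (x : Real.Angle) = 0) :
    ∃ F : Real.Angle → ℝ, ∀ x : ℝ, HasDerivAt (fun y : ℝ => F y) (k x) x := by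
  have hc : Continuous fun x : ℝ => k x := hk.comp Real.Angle.continuous_coe
  have hper : Function.Periodic (fun x : ℝ => ∫ y in (0 : ℝ)..x, k (y : Real.Angle))
      (2 * Real.pi) := by
    intro x
    have h1 := intervalIntegral.integral_add_adjacent_intervals (μ := volume)
      (hc.intervalIntegrable 0 x) (hc.intervalIntegrable x (x + 2 * Real.pi))
    have h2 := (periodic_coe k).intervalIntegral_add_eq x 0
    rw [zero_add] at h2
    simp only
    rw [← h1, h2, h0, add_zero]
  obtain ⟨F, hF⟩ := exists_lift hper
  refine ⟨F, fun x => ?_⟩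
  simp only [hF]
  exact (hc.integral_hasStrictDerivAt 0 x).hasDerivAt

section Uniqueness

variable {b β u : ℝ} (hb : 0 < b) (a : ℝ) (hβ : 0 < β) (hu : u ∈ Set.Ioo (0 : ℝ) 1)
include hb hβ

/-- The equation `p' + β v' p = q` has a periodic solution, since `exp (-β v)` has a multiplier
different from `1` over one period. -/
theorem exists_periodic_solution (u : ℝ) {q : Real.Angle → ℝ} (hq : Continuous q) :
    ∃ p : Real.Angle → ℝ, Continuous p ∧ ∀ x : ℝ, HasDerivAt (fun y : ℝ => p y)
      (q x + (rate β u 0 / angularSpeed b 0 x + rate β u 1 / angularSpeed b 1 x) * p x) x := by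
  have hv := continuous_v hb 0 u
  have hc : Continuous fun x : ℝ => Real.exp (β * v 0 b u x) * q x :=
    (Real.continuous_exp.comp (hv.const_mul β)).mul (hq.comp Real.Angle.continuous_coe)
  set I : ℝ := ∫ y in (0 : ℝ)..(2 * Real.pi), Real.exp (β * v 0 b u y) * q y with hI
  set m : ℝ := Real.exp (β * (2 * Real.pi)) with hm
  have hm1 : m - 1 ≠ 0 := by
    have : 1 < m := Real.one_lt_exp_iff.2 (mul_pos hβ Real.two_pi_pos)
    exact (sub_pos.2 this).ne'
  -- the initial value is the fixed point of the affine return map over one period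
  set p₀ : ℝ := I / (m - 1) with hp₀
  set g : ℝ → ℝ := fun x => Real.exp (-(β * v 0 b u x)) *
    (p₀ + ∫ y in (0 : ℝ)..x, Real.exp (β * v 0 b u y) * q y) with hg
  have hper : Function.Periodic g (2 * Real.pi) := by
    intro x
    have h1 := intervalIntegral.integral_add_adjacent_intervals (μ := volume)
      (hc.intervalIntegrable 0 (2 * Real.pi))
      (hc.intervalIntegrable (2 * Real.pi) (x + 2 * Real.pi))
    have h2 := intervalIntegral.integral_comp_add_right (a := 0) (b := x)
      (fun y : ℝ => Real.exp (β * v 0 b u y) * q y) (2 * Real.pi)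
    have h3 : ∀ y : ℝ, Real.exp (β * v 0 b u (y + 2 * Real.pi)) *
        q ((y + 2 * Real.pi : ℝ) : Real.Angle) = m * (Real.exp (β * v 0 b u y) * q y) := by
      intro y
      rw [v_add_two_pi hb, mul_add, Real.exp_add, Real.Angle.coe_add, Real.Angle.coe_two_pi,
        add_zero]
      ring
    simp only [h3, zero_add] at h2
    rw [intervalIntegral.integral_const_mul] at h2
    have h4 : Real.exp (-(β * v 0 b u (x + 2 * Real.pi))) * m = Real.exp (-(β * v 0 b u x)) := by
      rw [hm, ← Real.exp_add, v_add_two_pi hb]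
      congr 1
      ring
    have h5 : p₀ + I = m * p₀ := by
      rw [hp₀]
      field_simp
      ring
    simp only [hg]
    rw [← h1, ← h2, ← h4, ← add_assoc, ← hI, h5]
    ring
  obtain ⟨p, hp⟩ := exists_lift hper
  have hd : ∀ x : ℝ, HasDerivAt (fun y : ℝ => p y)
      (q x + (rate β u 0 / angularSpeed b 0 x + rate β u 1 / angularSpeed b 1 x) * p x) x := by
    intro x
    simp only [hp]
    have h1 := ((hasDerivAt_v hb 0 u x).const_mul β).neg.exp
    have h2 := (hc.integral_hasStrictDerivAt 0 x).hasDerivAt.const_add p₀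
    refine (h1.mul h2).congr_deriv ?_
    have hE : Real.exp (-(β * v 0 b u x)) * Real.exp (β * v 0 b u x) = 1 := by
      rw [← Real.exp_add, neg_add_cancel, Real.exp_zero]
    rw [angularSpeed_coe 0, angularSpeed_coe 0, show rate β u 0 = β * u from rfl,
      show rate β u 1 = β * (1 - u) from rfl]
    simp only [hg, Pi.neg_apply]
    linear_combination q x * hE
  exact ⟨p, continuous_of_comp_coe
    (continuous_iff_continuousAt.2 fun x => (hd x).continuousAt), hd⟩

include hu

theorem integral_generator_modes {ν : Measure (Real.Angle × Fin 2)} [IsProbabilityMeasure ν]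
    (hν : IsInvariant a b β u ν) {F F' : Fin 2 → Real.Angle → ℝ} (hF' : ∀ i, Continuous (F' i))
    (hF : ∀ i (x : ℝ), HasDerivAt (fun y : ℝ => F i y) (F' i x) x) :
    ∫ θ, (angularSpeed b 0 θ * F' 0 θ + rate β u 0 * (F 1 θ - F 0 θ)) ∂modeMarginal ν 0 +
    ∫ θ, (angularSpeed b 1 θ * F' 1 θ + rate β u 1 * (F 0 θ - F 1 θ)) ∂modeMarginal ν 1 = 0 := by
  have hFc : ∀ i, Continuous (F i) := fun i => continuous_of_comp_coe
    (continuous_iff_continuousAt.2 fun x => (hF i x).continuousAt)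
  rw [← integral_generator hb a hβ hu hν hF' hF,
    integral_eq_modeMarginal ν (H := fun i θ => angularSpeed b i θ * F' i θ +
      rate β u i * (F (1 - i) θ - F i θ))]
  · rfl
  · intro i
    exact ((continuous_angularSpeed b i).mul (hF' i)).add
      (continuous_const.mul ((hFc _).sub (hFc _)))

/-- The rotation rate of a measure. -/
noncomputable def rotationRate (b : ℝ) (ν : Measure (Real.Angle × Fin 2)) : ℝ :=
  ∫ θ, angularSpeed b 0 θ ∂modeMarginal ν 0 + ∫ θ, angularSpeed b 1 θ ∂modeMarginal ν 1

/-- The total angular current of an invariant measure is uniform: this is the stationarity equation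
tested on functions of the angle only. -/
theorem integral_current {ν : Measure (Real.Angle × Fin 2)} [IsProbabilityMeasure ν]
    (hν : IsInvariant a b β u ν) {k : Real.Angle → ℝ} (hk : Continuous k) :
    ∫ θ, angularSpeed b 0 θ * k θ ∂modeMarginal ν 0 +
      ∫ θ, angularSpeed b 1 θ * k θ ∂modeMarginal ν 1 =
      ((2 * Real.pi)⁻¹ * ∫ x in (0 : ℝ)..(2 * Real.pi), k (x : Real.Angle)) *
        rotationRate b ν := by
  set c := (2 * Real.pi)⁻¹ * ∫ x in (0 : ℝ)..(2 * Real.pi), k (x : Real.Angle) with hc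
  have hkc : Continuous fun x : ℝ => k x := hk.comp Real.Angle.continuous_coe
  have h0 : ∫ x in (0 : ℝ)..(2 * Real.pi), (k (x : Real.Angle) - c) = 0 := by
    rw [intervalIntegral.integral_sub (hkc.intervalIntegrable _ _)
      (continuous_const.intervalIntegrable _ _), intervalIntegral.integral_const, hc, sub_zero,
      smul_eq_mul, mul_inv_cancel_left₀ Real.two_pi_pos.ne', sub_self]
  obtain ⟨F, hF⟩ := exists_primitive (k := fun θ => k θ - c) (hk.sub continuous_const) h0
  have h := integral_generator_modes hb a hβ hu hν (F := fun _ => F) (F' := fun _ θ => k θ - c)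
    (fun _ => hk.sub continuous_const) (fun _ => hF)
  have hi : ∀ i, ∫ θ, angularSpeed b i θ * (k θ - c) ∂modeMarginal ν i =
      ∫ θ, angularSpeed b i θ * k θ ∂modeMarginal ν i -
        (∫ θ, angularSpeed b i θ ∂modeMarginal ν i) * c := by
    intro i
    simp only [mul_sub]
    rw [integral_sub, integral_mul_const]
    · exact integrable_of_continuous ((continuous_angularSpeed b i).mul hk)
    · exact integrable_of_continuous ((continuous_angularSpeed b i).mul continuous_const)
  simp only [sub_self, mul_zero, add_zero, hi] at h
  rw [rotationRate]
  linarith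

/-- All invariant probability measures are proportional to one and the same functional. -/
theorem exists_functional (i : Fin 2) {g : Real.Angle → ℝ} (hg : Continuous g) :
    ∃ σ : ℝ, ∀ ν : Measure (Real.Angle × Fin 2), IsProbabilityMeasure ν →
      IsInvariant a b β u ν → ∫ θ, g θ ∂modeMarginal ν i = σ * rotationRate b ν := by
  have hA := fun i => continuous_angularSpeed b i
  have hne : ∀ i θ, angularSpeed b i θ ≠ 0 := fun i θ => (angularSpeed_neg hb i θ).ne
  have hmode0 : ∀ {g : Real.Angle → ℝ}, Continuous g → ∃ σ : ℝ,
      ∀ ν : Measure (Real.Angle × Fin 2), IsProbabilityMeasure ν →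
      IsInvariant a b β u ν → ∫ θ, g θ ∂modeMarginal ν 0 = σ * rotationRate b ν := by
    intro g hg
    obtain ⟨p, hpc, hp⟩ := exists_periodic_solution hb hβ u (q := fun θ => g θ / angularSpeed b 0 θ)
      (hg.div (hA 0) (hne 0))
    have hk : Continuous fun θ => rate β u 1 * p θ / angularSpeed b 1 θ :=
      (hpc.const_mul _).div (hA 1) (hne 1)
    refine ⟨-((2 * Real.pi)⁻¹ * ∫ x in (0 : ℝ)..(2 * Real.pi),
      rate β u 1 * p x / angularSpeed b 1 x), fun ν hν hinv => ?_⟩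
    have h1 := integral_current hb a hβ hu hinv hk
    set p' : Real.Angle → ℝ := fun θ => g θ / angularSpeed b 0 θ +
      (rate β u 0 / angularSpeed b 0 θ + rate β u 1 / angularSpeed b 1 θ) * p θ with hp'
    have hp'c : Continuous p' := (hg.div (hA 0) (hne 0)).add
      (((continuous_const.div (hA 0) (hne 0)).add (continuous_const.div (hA 1) (hne 1))).mul hpc)
    have h2 := integral_generator_modes hb a hβ hu hinv (F := ![p, 0]) (F' := ![p', 0])
      (fun i => by
        fin_cases i
        · exact hp'c
        · exact continuous_zero)
      (fun i x => by
        fin_cases i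
        · exact hp x
        · exact hasDerivAt_const x (0 : ℝ))
    have e0 : ∀ θ, angularSpeed b 0 θ * p' θ + rate β u 0 * (0 - p θ) =
        g θ + angularSpeed b 0 θ * (rate β u 1 * p θ / angularSpeed b 1 θ) := by
      intro θ
      have n0 := hne 0 θ
      have n1 := hne 1 θ
      simp only [hp']
      field_simp
      ring
    have e1 : ∀ θ, angularSpeed b 1 θ * (rate β u 1 * p θ / angularSpeed b 1 θ) =
        rate β u 1 * p θ := fun θ => mul_div_cancel₀ _ (hne 1 θ)
    simp only [Matrix.cons_val_zero, Matrix.cons_val_one, Pi.zero_apply, mul_zero, zero_add,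
      sub_zero, e0] at h2
    simp only [e1] at h1
    have hk' : Continuous fun θ =>
        angularSpeed b 0 θ * (rate β u 1 * p θ / angularSpeed b 1 θ) := (hA 0).mul hk
    rw [integral_add (integrable_of_continuous hg) (integrable_of_continuous hk')] at h2
    linarith
  have hmode1 : ∃ σ : ℝ, ∀ ν : Measure (Real.Angle × Fin 2), IsProbabilityMeasure ν →
      IsInvariant a b β u ν → ∫ θ, g θ ∂modeMarginal ν 1 = σ * rotationRate b ν := by
    have hk : Continuous fun θ => g θ / angularSpeed b 1 θ := hg.div (hA 1) (hne 1)
    have hk' : Continuous fun θ => angularSpeed b 0 θ * (g θ / angularSpeed b 1 θ) := (hA 0).mul hk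
    obtain ⟨σ, hσ⟩ := hmode0 hk'
    refine ⟨(2 * Real.pi)⁻¹ * (∫ x in (0 : ℝ)..(2 * Real.pi),
      g (x : Real.Angle) / angularSpeed b 1 x) - σ, fun ν hν hinv => ?_⟩
    have h1 := integral_current hb a hβ hu hinv hk
    have e1 : ∀ θ, angularSpeed b 1 θ * (g θ / angularSpeed b 1 θ) = g θ := fun θ =>
      mul_div_cancel₀ _ (hne 1 θ)
    simp only [e1] at h1
    have h2 := hσ ν hν hinv
    linarith
  fin_cases i
  exacts [hmode0 hg, hmode1]

theorem invariant_unique {ν ν' : Measure (Real.Angle × Fin 2)} [hp : IsProbabilityMeasure ν]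
    [hp' : IsProbabilityMeasure ν'] (hν : IsInvariant a b β u ν)
    (hν' : IsInvariant a b β u ν') : ν = ν' := by
  have hmass : ∀ (ν : Measure (Real.Angle × Fin 2)) [IsProbabilityMeasure ν],
      ∫ _, (1 : ℝ) ∂modeMarginal ν 0 + ∫ _, (1 : ℝ) ∂modeMarginal ν 1 = 1 := by
    intro ν _
    rw [← integral_eq_modeMarginal ν (H := fun _ _ => 1) fun _ => continuous_const]
    simp
  obtain ⟨σ0, h0⟩ := exists_functional hb a hβ hu 0 (g := fun _ => 1) continuous_const
  obtain ⟨σ1, h1⟩ := exists_functional hb a hβ hu 1 (g := fun _ => 1) continuous_const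
  have e := hmass ν
  have e' := hmass ν'
  rw [h0 ν hp hν, h1 ν hp hν, ← add_mul] at e
  rw [h0 ν' hp' hν', h1 ν' hp' hν', ← add_mul] at e'
  have hrot : rotationRate b ν = rotationRate b ν' :=
    mul_left_cancel₀ (left_ne_zero_of_mul_eq_one e) (e.trans e'.symm)
  refine ext_modeMarginal fun i => ext_of_forall_integral_eq_of_IsFiniteMeasure fun g => ?_
  obtain ⟨σ, h⟩ := exists_functional hb a hβ hu i g.continuous
  rw [h ν hp hν, h ν' hp' hν', hrot]

end Uniqueness

end SwitchedSystem

theorem lemma2p1 (a b β u : ℝ) (ha : 0 < a) (hb : 1 < b) (hβ : 0 < β)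
    (hu : u ∈ Set.Ioo (0 : ℝ) 1) :
    -- the angular speeds
    (∀ θ : ℝ,
      SwitchedSystem.d a b 0 θ = -b * Real.sin θ ^ 2 - 1 / b * Real.cos θ ^ 2 ∧
      SwitchedSystem.d a b 1 θ = -(1 / b) * Real.sin θ ^ 2 - b * Real.cos θ ^ 2) ∧
    -- the function `v`
    (∀ θ : ℝ,
      HasDerivAt (SwitchedSystem.v a b u)
        (-(u / SwitchedSystem.d a b 0 θ + (1 - u) / SwitchedSystem.d a b 1 θ)) θ) ∧
    SwitchedSystem.v a b u 0 = 0 ∧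
    (∀ θ ∈ Set.Ioo (-(Real.pi / 2)) (Real.pi / 2),
      SwitchedSystem.v a b u θ =
        u * Real.arctan (b * Real.tan θ) + (1 - u) * Real.arctan (1 / b * Real.tan θ)) ∧
    (∀ θ : ℝ, SwitchedSystem.v a b u (θ + Real.pi) = SwitchedSystem.v a b u θ + Real.pi) ∧
    -- the constants are well defined
    IntegrableOn
      (fun α : ℝ => 1 / SwitchedSystem.d a b 1 α * Real.exp (-(β * SwitchedSystem.v a b u α)))
      (Set.Ioi 0) ∧
    0 < SwitchedSystem.kappa a b β u ∧
    SwitchedSystem.K a b β u < 0 ∧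
    SwitchedSystem.C a b β u < 0 ∧
    -- the linear differential equation solved by `Φ`
    (∀ θ : ℝ,
      HasDerivAt (SwitchedSystem.Phi a b β u)
        (-β * SwitchedSystem.Phi a b β u θ *
            (u / SwitchedSystem.d a b 0 θ + (1 - u) / SwitchedSystem.d a b 1 θ) +
          β * SwitchedSystem.C a b β u * (1 - u) / SwitchedSystem.d a b 1 θ) θ) ∧
    -- the densities are continuous, periodic and positive
    (∀ i : Fin 2,
      Continuous (SwitchedSystem.rho a b β u i) ∧
      Function.Periodic (SwitchedSystem.rho a b β u i) (2 * Real.pi) ∧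
      ∀ θ : ℝ, 0 < SwitchedSystem.rho a b β u i θ) ∧
    -- they define the unique invariant probability measure
    IsProbabilityMeasure (SwitchedSystem.densityMeasure (SwitchedSystem.rho a b β u)) ∧
    SwitchedSystem.IsInvariant a b β u
      (SwitchedSystem.densityMeasure (SwitchedSystem.rho a b β u)) ∧
    (∀ ν : Measure (Real.Angle × Fin 2), IsProbabilityMeasure ν →
      SwitchedSystem.IsInvariant a b β u ν →
      ν = SwitchedSystem.densityMeasure (SwitchedSystem.rho a b β u)) := by
  have hb0 : 0 < b := one_pos.trans hb
  refine ⟨fun θ => ⟨?_, ?_⟩, SwitchedSystem.hasDerivAt_v hb0 a u, ?_,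
    fun θ hθ => SwitchedSystem.v_eq_arctan hb0 a u hθ, SwitchedSystem.v_add_pi hb0 a u,
    SwitchedSystem.integrableOn_weight hb0 a hβ hu 0, SwitchedSystem.kappa_pos hb0 a hβ hu,
    SwitchedSystem.K_neg hb0 a hβ hu, SwitchedSystem.C_neg hb0 a hβ hu,
    SwitchedSystem.hasDerivAt_Phi hb0 a, fun i => ⟨SwitchedSystem.continuous_rho hb0 a hβ hu i,
      SwitchedSystem.rho_periodic hb0 a hβ hu i, SwitchedSystem.rho_pos hb0 a hβ hu i⟩,
    SwitchedSystem.isProbabilityMeasure_density hb0 a hβ hu,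
    SwitchedSystem.isInvariant_density hb0 a hβ hu, fun ν hν hinv => ?_⟩
  · rw [SwitchedSystem.d_eq]
    simp only [SwitchedSystem.axis, Matrix.cons_val_zero]
    ring
  · have h : SwitchedSystem.axis b 1 = 1 / b := rfl
    rw [SwitchedSystem.d_eq, h, one_div_one_div]
    ring
  · simp [SwitchedSystem.v]
  · have := SwitchedSystem.isProbabilityMeasure_density hb0 a hβ hu
    exact SwitchedSystem.invariant_unique hb0 a hβ hu hinv
      (SwitchedSystem.isInvariant_density hb0 a hβ hu)
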